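/- **Setting.** For an odd prime power $q$, let $\mathbb F_q$ be the field with $q$ elements and, for $x\in\mathbb F_q^2$, put $\|x\|=x_1^2+x_2^2$. Only those $q$ are considered for which $3$ is a square in $\mathbb F_q$, and for every such field a radius $t=t_q\in\mathbb F_q\setminus\{0\}$ is fixed (arbitrarily). Write $S_t$ for the indicator function of $\{x\in\mathbb F_q^2:\|x\|=t\}$. For $f:\mathbb F_q^2\to\mathbb R$ let $\|f\|_p=\big(q^{-2}\sum_x|f(x)|^p\big)^{1/p}$ for $1\le p<\infty$ and $\|f\|_\infty=\max_x|f(x)|$. For a graph $G$ with ordered vertex set $\{1,\dots,n\}$ and edge set $\mathcal E(G)$ let $$\Lambda_G(f_1,\dots,f_n)=\frac1{\mathcal N(G)}\sum_{x^1,\dots,x^n\in\mathbb F_q^2}\ \prod_{(i,j)\in\mathcal E(G)}S_t(x^i-x^j)\ \prod_{l=1}^n f_l(x^l),$$ where $\mathcal N(G)$ is the number of $(x^1,\dots,x^n)\in(\mathbb F_q^2)^n$ with $\|x^i-x^j\|=t$ for every edge $\{i,j\}$ of $G$. For $1\le p_1,\dots,p_n\le\infty$ let $\Lambda_G(p_1,\dots,p_n)$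 be the smallest constant $C$ such that $$\Lambda_G(f_1,\dots,f_n)\le C\prod_{i=1}^n\|f_i\|_{p_i}\qquad(*)$$ for all functions $f_i:\mathbb F_q^2\to[0,\infty)$. Write $\Lambda_G(p_1,\dots,p_n)\lesssim1$ if $\Lambda_G(p_1,\dots,p_n)\le C$ with a constant $C$ independent of $q$, and $\Lambda_G(p_1,\dots,p_n)\lessapprox1$ if $(*)$ holds, with a constant $C$ independent of $q$, whenever all the $f_i$ are indicator functions of subsets of $\mathbb F_q^2$. Let $\delta(G)$ denote the minimum degree of $G$. The graphs considered are, up to the order of their vertices: for $n=3$, the triangle $K_3$ and the path $P_2$ with two edges; for $n=4$, the cycle $C_4$, $C_4$ + diagonal, the path $P_3$ with three edges, $K_3$ + tail (a triangle and a fourth vertex joined to exactly one vertex of it), and the $Y$-shape (one vertex joined to the three others). These are all the connected graphs on $3$ or $4$ vertices except $K_4$. **Theorem.** Let $n\in\{3,4\}$, let $G$ and $G'$ be graphs from this list on the same ordered vertex set $\{1,\dots,n\}$, with $G'$ a subgraph of $G$, and suppose that $\min\{\delta(G),2\}>\delta(G')$. Let $1\le p_1,\dots,p_n\le\infty$. 1.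 If $\Lambda_G(p_1,\dots,p_n)\lesssim1$, then $\Lambda_{G'}(p_1,\dots,p_n)\lesssim1$, except possibly in the following endpoint case: $G$ is $C_4$ + diagonal, $G'$ is $K_3$ + tail, $p_i=2$ at the three vertices of the triangle of $G'$, and $p_i=\infty$ at the end of the tail. 2. In that endpoint case, $\Lambda_{G'}(p_1,\dots,p_n)\lessapprox1$. -/

import Mathlib

open scoped ENNReal NNReal

/-- `‖x‖ = x₁² + ⋯ + x_d²` for `x ∈ F^d`. -/
def sqNorm {F : Type} [Field F] {d : ℕ} (x : Fin d → F) : F := ∑ i, x i ^ 2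

open Classical in
/-- The kernel `K(x, y) = S_t(x - y)`, where `S_t` is (the indicator function of) the sphere
`{x : ‖x‖ = t}`. -/
noncomputable def sphereKernel {F : Type} [Field F] {d : ℕ} (t : F) (x y : Fin d → F) : ℝ :=
  if sqNorm (x - y) = t then 1 else 0

/-- The norm `‖f‖_p`, `1 ≤ p ≤ ∞`, with respect to the normalized counting measure on `F^d`. -/
noncomputable def avgNorm {F : Type} [Field F] [Fintype F] {d : ℕ} (p : ℝ≥0∞)
    (f : (Fin d → F) → ℝ) : ℝ :=
  if p = ∞ then ⨆ x, |f x|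
  else (((Fintype.card F : ℝ) ^ d)⁻¹ * ∑ x, |f x| ^ p.toReal) ^ (1 / p.toReal)

/-- The normalizing factor `𝒩(G)`: the number of placements `(x¹, …, xⁿ)` of the vertices
of `G` in `F^d` for which the endpoints of each edge of `G` are at distance `t`. -/
noncomputable def numPlacements {F : Type} [Field F] (d : ℕ) (t : F) {n : ℕ}
    (G : SimpleGraph (Fin n)) : ℕ :=
  Nat.card {x : Fin n → Fin d → F // ∀ i j, G.Adj i j → sqNorm (x i - x j) = t}

open Classical in
/-- The multilinear form `Λ_G(f₁, …, f_n)` on functions on `F^d`; each edge `{i, j}` of `G`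
contributes one factor, as the pair `(i, j)` with `i < j`. -/
noncomputable def graphForm {F : Type} [Field F] [Fintype F] {d : ℕ} (t : F) {n : ℕ}
    (G : SimpleGraph (Fin n)) (f : Fin n → (Fin d → F) → ℝ) : ℝ :=
  (numPlacements d t G : ℝ)⁻¹ *
    ∑ x : Fin n → Fin d → F,
      (∏ e : Fin n × Fin n with e.1 < e.2 ∧ G.Adj e.1 e.2, sphereKernel t (x e.1) (x e.2)) *
        ∏ l, f l (x l)

/-- `Λ_G(f₁, …, f_n) ≤ C ∏ ‖f_i‖_{p_i}` for all non-negative functions `f_i` on `F^d`. -/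
def IsFormBound {F : Type} [Field F] [Fintype F] (d : ℕ) (t : F) {n : ℕ}
    (G : SimpleGraph (Fin n)) (p : Fin n → ℝ≥0∞) (C : ℝ≥0) : Prop :=
  ∀ f : Fin n → (Fin d → F) → ℝ, (∀ i x, 0 ≤ f i x) →
    graphForm t G f ≤ C * ∏ i, avgNorm (p i) (f i)

/-- `Λ_G(p₁, …, p_n)`: the smallest constant in the inequality above. -/
noncomputable def formNorm {F : Type} [Field F] [Fintype F] (d : ℕ) (t : F) {n : ℕ}
    (G : SimpleGraph (Fin n)) (p : Fin n → ℝ≥0∞) : ℝ≥0∞ :=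
  ⨅ (C : ℝ≥0) (_ : IsFormBound d t G p C), (C : ℝ≥0∞)

/-- The finite fields considered: odd order and, in dimension two, `3` is a square. -/
def IsAdmissibleField (d : ℕ) (F : Type) [Field F] : Prop :=
  ringChar F ≠ 2 ∧ (d = 2 → IsSquare (3 : F))

/-- `Λ_G(p₁, …, p_n) ≲ 1` in dimension `d`: the constants `Λ_G(p₁, …, p_n)` are bounded
uniformly in the finite field; `t F` is the radius used over the field `F`. -/
def FormBounded (d : ℕ) (t : ∀ (F : Type) [Field F] [Fintype F], F) {n : ℕ}
    (G : SimpleGraph (Fin n)) (p : Fin n → ℝ≥0∞) : Prop :=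
  ∃ C : ℝ≥0, 1 ≤ C ∧ ∀ (F : Type) [Field F] [Fintype F], IsAdmissibleField d F →
    formNorm d (t F) G p ≤ C

/-- `Λ_G(p₁, …, p_n) ⪅ 1`: the inequality `Λ_G(f₁, …, f_n) ≤ C ∏ ‖f_i‖_{p_i}` holds,
uniformly in the finite field, for the indicator functions `f_i` of all sets `E_i ⊆ F^d`. -/
def FormRestrictedBounded (d : ℕ) (t : ∀ (F : Type) [Field F] [Fintype F], F) {n : ℕ}
    (G : SimpleGraph (Fin n)) (p : Fin n → ℝ≥0∞) : Prop :=
  ∃ C : ℝ≥0, 1 ≤ C ∧ ∀ (F : Type) [Field F] [Fintype F], IsAdmissibleField d F →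
    ∀ E : Fin n → Set (Fin d → F),
      graphForm (t F) G (fun i => (E i).indicator 1) ≤
        C * ∏ i, avgNorm (p i) ((E i).indicator (1 : (Fin d → F) → ℝ))

/-- The triangle `K₃`. -/
def graphK3 : SimpleGraph (Fin 3) := .fromEdgeSet {s(0, 1), s(1, 2), s(2, 0)}

/-- The path `P₂` of length two. -/
def graphP2 : SimpleGraph (Fin 3) := .fromEdgeSet {s(0, 1), s(1, 2)}

/-- The four-cycle with a diagonal. -/
def graphC4Diag : SimpleGraph (Fin 4) :=
  .fromEdgeSet {s(0, 1), s(1, 2), s(2, 3), s(3, 0), s(0, 2)}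

/-- The four-cycle `C₄`. -/
def graphC4 : SimpleGraph (Fin 4) := .fromEdgeSet {s(0, 1), s(1, 2), s(2, 3), s(3, 0)}

/-- The path `P₃` of length three. -/
def graphP3 : SimpleGraph (Fin 4) := .fromEdgeSet {s(0, 1), s(1, 2), s(2, 3)}

/-- `K₃` + tail (the kite): the tail joins the third vertex to the fourth. -/
def graphK3Tail : SimpleGraph (Fin 4) := .fromEdgeSet {s(0, 1), s(1, 2), s(2, 0), s(2, 3)}

/-- The `Y`-shaped graph. -/
def graphY : SimpleGraph (Fin 4) := .fromEdgeSet {s(2, 0), s(2, 1), s(2, 3)}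

/-- `G` is, up to the order of its vertices, one of the (connected) graphs studied with three
or four vertices. -/
def IsStudiedGraph {n : ℕ} (G : SimpleGraph (Fin n)) : Prop :=
  Nonempty (graphK3 ≃g G) ∨ Nonempty (graphP2 ≃g G) ∨ Nonempty (graphC4Diag ≃g G) ∨
    Nonempty (graphC4 ≃g G) ∨ Nonempty (graphP3 ≃g G) ∨ Nonempty (graphK3Tail ≃g G) ∨
    Nonempty (graphY ≃g G)

/-- The exceptional endpoint: in some order of the vertices, `G` is `C₄` + diagonal, `G'` is
`K₃` + tail, and the exponents are `(2, 2, 2, ∞)`, with `∞` at the end of the tail. -/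
def IsExceptionalEndpoint {n : ℕ} (G G' : SimpleGraph (Fin n)) (p : Fin n → ℝ≥0∞) : Prop :=
  ∃ σ : Fin 4 ≃ Fin n, G.comap σ = graphC4Diag ∧ G'.comap σ = graphK3Tail ∧
    ∀ i, p (σ i) = (![2, 2, 2, ∞] : Fin 4 → ℝ≥0∞) i

/-- The infimum defining `formNorm` is attained, so it is the smallest constant. -/
theorem formNorm_le_coe_iff {F : Type} [Field F] [Fintype F] (d : ℕ) (t : F) {n : ℕ}
    (G : SimpleGraph (Fin n)) (p : Fin n → ℝ≥0∞) (C : ℝ≥0) :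
    formNorm d t G p ≤ C ↔ IsFormBound d t G p C := by
  refine ⟨fun h f hf => ?_, fun h => iInf₂_le C h⟩
  have hP : 0 ≤ ∏ i, avgNorm (p i) (f i) := by
    refine Finset.prod_nonneg fun i _ => ?_
    unfold avgNorm
    split_ifs
    · exact Real.iSup_nonneg fun x => abs_nonneg _
    · refine Real.rpow_nonneg (mul_nonneg (by positivity) ?_) _
      exact Finset.sum_nonneg fun x _ => Real.rpow_nonneg (abs_nonneg _) _
  have key : ∀ ε : ℝ≥0, 0 < ε →
      graphForm t G f ≤ ((C + ε : ℝ≥0) : ℝ) * ∏ i, avgNorm (p i) (f i) := by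
    intro ε hε
    have hlt : formNorm d t G p < ((C + ε : ℝ≥0) : ℝ≥0∞) :=
      lt_of_le_of_lt h (by exact_mod_cast lt_add_of_pos_right C hε)
    unfold formNorm at hlt
    simp only [iInf_lt_iff] at hlt
    obtain ⟨C', hC', hlt'⟩ := hlt
    refine (hC' f hf).trans (mul_le_mul_of_nonneg_right ?_ hP)
    exact_mod_cast (ENNReal.coe_lt_coe.mp hlt').le
  rcases hP.eq_or_lt with h0 | hpos
  · simpa [← h0] using key 1 one_pos
  · refine le_of_forall_pos_le_add fun δ hδ => ?_
    have hq : 0 < δ / ∏ i, avgNorm (p i) (f i) := div_pos hδ hpos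
    have := key (Real.toNNReal (δ / ∏ i, avgNorm (p i) (f i))) (Real.toNNReal_pos.mpr hq)
    rw [NNReal.coe_add, Real.coe_toNNReal _ hq.le, add_mul, div_mul_cancel₀ _ hpos.ne'] at this
    exact this

/-!
Put `a i = 1 / p i`. By homogeneity, boundedness at `p` is a bound for the form evaluated at powers
`φ i ^ a i` of densities, and the exponents `a` for which such a bound holds form a convex set.

If `G'` has minimum degree `1`, then `a` is admissible as soon as it lies in the polytope spanned by
the points equal to `2 / (|s| + 1)` on a set `s` of at most three vertices and to `0` elsewhere.
A leaf on which `a` does not vanish is removed by the `L^(3/2) → L^3` bound for circular averages,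
which holds because two distinct points have at most two common neighbours. The triangle is handled
at `p = (2, 2, 2)` by Cauchy–Schwarz.

If `G` has minimum degree `2`, then testing the form on circles about a point, and on that point at
a set of vertices adjacent to all the others, gives linear inequalities which place `a` in the same
polytope. It suffices to test over the fields of order `3 ^ k`, in which `3 = 0` is a square.
The exceptional endpoint is a vertex of the polytope.
-/

theorem prod_rpow_convexCombination_le {ι : Type*} [Fintype ι] {u a b : ι → ℝ} (hu : 0 ≤ u)
    (ha : 0 ≤ a) (hb : 0 ≤ b) {s r : ℝ} (hs : 0 ≤ s) (hr : 0 ≤ r) (hsr : s + r = 1) :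
    ∏ i, u i ^ (s • a + r • b) i ≤ s * ∏ i, u i ^ a i + r * ∏ i, u i ^ b i := by
  have hpow (c : ι → ℝ) (i : ι) : 0 ≤ u i ^ c i := Real.rpow_nonneg (hu i) _
  calc ∏ i, u i ^ (s • a + r • b) i = ∏ i, (u i ^ a i) ^ s * (u i ^ b i) ^ r := by
        refine Finset.prod_congr rfl fun i _ => ?_
        rw [← Real.rpow_mul (hu i), ← Real.rpow_mul (hu i), ← Real.rpow_add_of_nonneg (hu i)
          (mul_nonneg (ha i) hs) (mul_nonneg (hb i) hr)]
        simp [mul_comm]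
    _ = (∏ i, u i ^ a i) ^ s * (∏ i, u i ^ b i) ^ r := by
        rw [Finset.prod_mul_distrib, Real.finsetProd_rpow _ _ fun i _ => hpow a i,
          Real.finsetProd_rpow _ _ fun i _ => hpow b i]
    _ ≤ _ := Real.geom_mean_le_arith_mean2_weighted hs hr
        (Finset.prod_nonneg fun i _ => hpow a i) (Finset.prod_nonneg fun i _ => hpow b i) hsr

section Exponents

variable {ι κ V : Type*} [DecidableEq ι] [DecidableEq κ] [Fintype V]

/-- A non-negative function whose average is at most one. -/
def IsDensity (φ : V → ℝ) : Prop :=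
  (∀ x, 0 ≤ φ x) ∧ ∑ x, φ x ≤ Fintype.card V

/-- The multilinear form with weight `w` is bounded by `C` on the functions `φ i ^ a i`, where
the `φ i` are densities; this is the bound with exponents `p i = 1 / a i` by homogeneity. -/
def PowerBound [Fintype ι] (w : (ι → V) → ℝ) (a : ι → ℝ) (C : ℝ) : Prop :=
  ∀ φ : ι → V → ℝ, (∀ i, IsDensity (φ i)) → ∑ x : ι → V, w x * ∏ i, φ i (x i) ^ a i ≤ C

/-- The exponent vector with entries `2 / (|s| + 1)` on `s` and zero elsewhere. -/
noncomputable def vertexExponent (s : Finset ι) (i : ι) : ℝ :=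
  if i ∈ s then 2 / (s.card + 1) else 0

/-- The multilinear form with weight `w` is bounded by `C` at all the exponent vectors that span
`exponentRegion`. -/
def VertexBound [Fintype ι] (w : (ι → V) → ℝ) (C : ℝ) : Prop :=
  ∀ s : Finset ι, s.card ≤ 3 → PowerBound w (vertexExponent s) C

variable (ι) in
/-- The convex hull of the exponent vectors `vertexExponent s` with `|s| ≤ 3`. -/
def exponentRegion : Set (ι → ℝ) :=
  convexHull ℝ (vertexExponent '' {s : Finset ι | s.card ≤ 3})

theorem isDensity_one : IsDensity (fun _ : V => (1 : ℝ)) :=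
  ⟨fun _ => zero_le_one, by simp⟩

theorem vertexExponent_nonneg (s : Finset ι) : 0 ≤ vertexExponent s := by
  intro i
  unfold vertexExponent
  split_ifs
  · positivity
  · exact le_rfl

theorem vertexExponent_comp (e : κ ≃ ι) (s : Finset ι) :
    vertexExponent s ∘ e = vertexExponent (s.map e.symm.toEmbedding) := by
  ext k
  simp [vertexExponent, Finset.mem_map_equiv]

theorem vertexExponent_mem_exponentRegion {s : Finset ι} (hs : s.card ≤ 3) :
    vertexExponent s ∈ exponentRegion ι :=
  subset_convexHull ℝ _ ⟨s, hs, rfl⟩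

variable [Fintype ι] [Fintype κ] {w : (ι → V) → ℝ} {a : ι → ℝ} {C C' : ℝ}

theorem PowerBound.mono (h : PowerBound w a C) (hC : C ≤ C') : PowerBound w a C' :=
  fun φ hφ => (h φ hφ).trans hC

theorem PowerBound.reindex (e : κ ≃ ι)
    (h : PowerBound (fun y : κ → V => w (y ∘ e.symm)) (a ∘ e) C) : PowerBound w a C := by
  intro φ hφ
  refine le_of_eq_of_le ?_ (h (fun k => φ (e k)) fun k => hφ (e k))
  refine Fintype.sum_equiv (e.symm.arrowCongr (Equiv.refl V)) _ _ fun x => ?_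
  congr 1
  · congr 1
    ext i
    simp [Equiv.arrowCongr]
  · refine (Fintype.prod_equiv e _ _ fun k => ?_).symm
    simp [Equiv.arrowCongr]

theorem convex_powerBound (hw : 0 ≤ w) (C : ℝ) :
    Convex ℝ {a : ι → ℝ | 0 ≤ a ∧ PowerBound w a C} := by
  rintro a ⟨ha, hA⟩ b ⟨hb, hB⟩ s r hs hr hsr
  refine ⟨add_nonneg (smul_nonneg hs ha) (smul_nonneg hr hb), fun φ hφ => ?_⟩
  calc ∑ x : ι → V, w x * ∏ i, φ i (x i) ^ (s • a + r • b) i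
      ≤ ∑ x : ι → V, w x * (s * ∏ i, φ i (x i) ^ a i + r * ∏ i, φ i (x i) ^ b i) :=
        Finset.sum_le_sum fun x _ => mul_le_mul_of_nonneg_left
          (prod_rpow_convexCombination_le (fun i => (hφ i).1 _) ha hb hs hr hsr) (hw x)
    _ = s * (∑ x : ι → V, w x * ∏ i, φ i (x i) ^ a i) +
        r * ∑ x : ι → V, w x * ∏ i, φ i (x i) ^ b i := by
        rw [Finset.mul_sum, Finset.mul_sum, ← Finset.sum_add_distrib]
        exact Finset.sum_congr rfl fun x _ => by ring
    _ ≤ s * C + r * C :=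
        add_le_add (mul_le_mul_of_nonneg_left (hA φ hφ) hs)
          (mul_le_mul_of_nonneg_left (hB φ hφ) hr)
    _ = C := by rw [← add_mul, hsr, one_mul]

theorem VertexBound.mono (h : VertexBound w C) (hC : C ≤ C') : VertexBound w C' :=
  fun s hs => (h s hs).mono hC

theorem VertexBound.reindex (e : κ ≃ ι)
    (h : VertexBound (fun y : κ → V => w (y ∘ e.symm)) C) : VertexBound w C := by
  intro s hs
  refine PowerBound.reindex e ?_
  rw [vertexExponent_comp]
  exact h _ (by simpa using hs)

theorem VertexBound.powerBound (hw : 0 ≤ w) (h : VertexBound w C) (ha : a ∈ exponentRegion ι) :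
    PowerBound w a C := by
  have hsub : exponentRegion ι ⊆ {a : ι → ℝ | 0 ≤ a ∧ PowerBound w a C} := by
    refine convexHull_min ?_ (convex_powerBound hw C)
    rintro _ ⟨s, hs, rfl⟩
    exact ⟨vertexExponent_nonneg s, h s hs⟩
  exact (hsub ha).2

end Exponents

theorem sum_mul_sq_pow_three_le {ι : Type*} (s : Finset ι) {c u : ι → ℝ}
    (hc : ∀ i ∈ s, 0 ≤ c i) (hu : ∀ i ∈ s, 0 ≤ u i) :
    (∑ i ∈ s, c i * u i ^ 2) ^ 3 ≤ (∑ i ∈ s, c i) * (∑ i ∈ s, c i * u i ^ 3) ^ 2 := by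
  have hmom (k : ℕ) : ∀ i ∈ s, 0 ≤ c i * u i ^ k := fun i hi =>
    mul_nonneg (hc i hi) (pow_nonneg (hu i hi) k)
  have h₁ : (∑ i ∈ s, c i * u i ^ 1) ^ 2 ≤ (∑ i ∈ s, c i) * ∑ i ∈ s, c i * u i ^ 2 :=
    Finset.sum_sq_le_sum_mul_sum_of_sq_le_mul s hc (hmom 2) fun i _ => le_of_eq (by ring)
  have h₂ : (∑ i ∈ s, c i * u i ^ 2) ^ 2 ≤
      (∑ i ∈ s, c i * u i ^ 1) * ∑ i ∈ s, c i * u i ^ 3 :=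
    Finset.sum_sq_le_sum_mul_sum_of_sq_le_mul s (hmom 1) (hmom 3) fun i _ => le_of_eq (by ring)
  have hM := Finset.sum_nonneg (hmom 2)
  set M₀ := ∑ i ∈ s, c i
  set M₁ := ∑ i ∈ s, c i * u i ^ 1
  set M₂ := ∑ i ∈ s, c i * u i ^ 2
  set M₃ := ∑ i ∈ s, c i * u i ^ 3
  rcases hM.eq_or_lt with h0 | hpos
  · rw [← h0, zero_pow three_ne_zero]
    exact mul_nonneg (Finset.sum_nonneg hc) (sq_nonneg _)
  · refine le_of_mul_le_mul_left ?_ hpos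
    calc M₂ * M₂ ^ 3 = (M₂ ^ 2) ^ 2 := by ring
      _ ≤ (M₁ * M₃) ^ 2 := by gcongr
      _ = M₁ ^ 2 * M₃ ^ 2 := by ring
      _ ≤ M₀ * M₂ * M₃ ^ 2 := by gcongr
      _ = M₂ * (M₀ * M₃ ^ 2) := by ring

theorem sum_mul_sum_eq_sum_add_sum_offDiag {ι : Type*} (s : Finset ι) (f g : ι → ℝ) :
    (∑ i ∈ s, f i) * ∑ i ∈ s, g i = ∑ i ∈ s, f i * g i + ∑ p ∈ s.offDiag, f p.1 * g p.2 := by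
  classical
  rw [Finset.sum_mul_sum, ← Finset.sum_product', ← Finset.diag_union_offDiag,
    Finset.sum_union (Finset.disjoint_diag_offDiag s), Finset.sum_diag]

theorem pow_three_le_of_sq_eq_add {S Q P M : ℝ} (hS : 0 ≤ S) (hQ : 0 ≤ Q) (hM : 0 ≤ M)
    (hsq : S ^ 2 = Q + P) (hP : P ^ 3 ≤ M ^ 2) : S ^ 3 ≤ 2 * (S * Q) + 3 * M := by
  rcases le_total P Q with hPQ | hQP
  · calc S ^ 3 = S * (Q + P) := by rw [← hsq]; ring
      _ ≤ S * (Q + Q) := by gcongr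
      _ ≤ 2 * (S * Q) + 3 * M := by linarith
  · have hS₃ : S ^ 3 ≤ 3 * M := by
      refine le_of_sq_le_sq ?_ (by positivity)
      calc (S ^ 3) ^ 2 = (Q + P) ^ 3 := by rw [← hsq]; ring
        _ ≤ (P + P) ^ 3 := pow_le_pow_left₀ (hsq ▸ sq_nonneg S) (by linarith) 3
        _ = 8 * P ^ 3 := by ring
        _ ≤ (3 * M) ^ 2 := by linarith [sq_nonneg M, mul_pow 3 M 2]
    linarith [mul_nonneg hS hQ]

theorem pow_three_sum_sq_le {ι : Type*} [Fintype ι] {c r : ι → ℝ} (hc : 0 ≤ c) (hr : 0 ≤ r) :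
    (∑ i, c i * r i ^ 2) ^ 3 ≤
      2 * ((∑ i, c i * r i ^ 2) * ∑ i, c i * (c i * r i ^ 4)) +
      3 * ((∑ i, c i) * ∑ p ∈ Finset.univ.offDiag, c p.1 * r p.1 ^ 3 * (c p.2 * r p.2 ^ 3)) := by
  have hmom (k : ℕ) (i : ι) : 0 ≤ c i * r i ^ k := mul_nonneg (hc i) (pow_nonneg (hr i) k)
  have hpair (k : ℕ) : ∑ p ∈ Finset.univ.offDiag, c p.1 * c p.2 * (r p.1 * r p.2) ^ k =
      ∑ p ∈ Finset.univ.offDiag, c p.1 * r p.1 ^ k * (c p.2 * r p.2 ^ k) :=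
    Finset.sum_congr rfl fun p _ => by ring
  have hO : 0 ≤ ∑ p ∈ Finset.univ.offDiag, c p.1 * r p.1 ^ 3 * (c p.2 * r p.2 ^ 3) :=
    Finset.sum_nonneg fun p _ => mul_nonneg (hmom 3 _) (hmom 3 _)
  refine pow_three_le_of_sq_eq_add
    (P := ∑ p ∈ Finset.univ.offDiag, c p.1 * r p.1 ^ 2 * (c p.2 * r p.2 ^ 2))
    (Finset.sum_nonneg fun i _ => hmom 2 i)
    (Finset.sum_nonneg fun i _ => mul_nonneg (hc i) (hmom 4 i))
    (mul_nonneg (Finset.sum_nonneg fun i _ => hc i) hO) ?_ ?_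
  · rw [sq, sum_mul_sum_eq_sum_add_sum_offDiag]
    exact congrArg (· + _) (Finset.sum_congr rfl fun i _ => by ring)
  · have hcc : ∑ p ∈ Finset.univ.offDiag, c p.1 * c p.2 ≤ (∑ i, c i) ^ 2 := by
      rw [sq, sum_mul_sum_eq_sum_add_sum_offDiag]
      exact le_add_of_nonneg_left (Finset.sum_nonneg fun i _ => mul_self_nonneg _)
    rw [← hpair 2, ← hpair 3, mul_pow]
    exact (sum_mul_sq_pow_three_le _ (fun p _ => mul_nonneg (hc _) (hc _))
      fun p _ => mul_nonneg (hr _) (hr _)).trans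
      (mul_le_mul_of_nonneg_right hcc (sq_nonneg _))

/-- The properties of the circle kernel in a plane with `q ^ 2` points that the bounds use: `K` is
the adjacency matrix of a `D`-regular graph, `D` being comparable to `q`, in which two distinct
vertices have at most two common neighbours. -/
structure IsCircleKernel {V : Type*} [Fintype V] (K : V → V → ℝ) (q D : ℝ) : Prop where
  zero_or_one : ∀ x y, K x y = 0 ∨ K x y = 1
  symm : ∀ x y, K x y = K y x
  irrefl : ∀ x, K x x = 0
  degree : ∀ x, ∑ y, K x y = D
  common : ∀ x y, x ≠ y → ∑ z, K z x * K z y ≤ 2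
  card : (Fintype.card V : ℝ) = q ^ 2
  one_le : 1 ≤ q
  degree_le : D ≤ 2 * q
  le_degree : q ≤ 3 * D

namespace IsCircleKernel

variable {V : Type*} [Fintype V] {K : V → V → ℝ} {q D : ℝ}

theorem nonneg (h : IsCircleKernel K q D) (x y : V) : 0 ≤ K x y := by
  rcases h.zero_or_one x y with h | h <;> simp [h]

theorem mul_self (h : IsCircleKernel K q D) (x y : V) : K x y * K x y = K x y := by
  rcases h.zero_or_one x y with h | h <;> simp [h]

theorem pos (h : IsCircleKernel K q D) : 0 < q := one_pos.trans_le h.one_le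

theorem degree_pos (h : IsCircleKernel K q D) : 0 < D := by
  linarith [h.one_le, h.le_degree]

theorem degree_symm (h : IsCircleKernel K q D) (y : V) : ∑ x, K x y = D := by
  rw [← h.degree y, Finset.sum_congr rfl fun x _ => h.symm x y]

theorem sum_sum_offDiag_le (h : IsCircleKernel K q D) {f g : V → ℝ} (hf : 0 ≤ f) (hg : 0 ≤ g) :
    ∑ x, ∑ p ∈ Finset.univ.offDiag, K x p.1 * f p.1 * (K x p.2 * g p.2) ≤
      2 * ((∑ y, f y) * ∑ z, g z) := by
  calc ∑ x, ∑ p ∈ Finset.univ.offDiag, K x p.1 * f p.1 * (K x p.2 * g p.2)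
      = ∑ p ∈ Finset.univ.offDiag, (∑ x, K x p.1 * K x p.2) * (f p.1 * g p.2) := by
        rw [Finset.sum_comm]
        refine Finset.sum_congr rfl fun p _ => ?_
        rw [Finset.sum_mul]
        exact Finset.sum_congr rfl fun x _ => by ring
    _ ≤ ∑ p ∈ Finset.univ.offDiag, 2 * (f p.1 * g p.2) :=
        Finset.sum_le_sum fun p hp => mul_le_mul_of_nonneg_right
          (h.common _ _ (Finset.mem_offDiag.1 hp).2.2) (mul_nonneg (hf _) (hg _))
    _ ≤ 2 * ((∑ y, f y) * ∑ z, g z) := by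
        rw [← Finset.mul_sum, sum_mul_sum_eq_sum_add_sum_offDiag]
        have : 0 ≤ ∑ y, f y * g y := Finset.sum_nonneg fun y _ => mul_nonneg (hf y) (hg y)
        linarith

theorem sum_sum_mul_sum_le (h : IsCircleKernel K q D) {f g : V → ℝ} (hf : 0 ≤ f) (hg : 0 ≤ g) :
    ∑ x, (∑ y, K x y * f y) * ∑ z, K x z * g z ≤
      D * ∑ y, f y * g y + 2 * ((∑ y, f y) * ∑ z, g z) := by
  have hdiag : ∑ x, ∑ y, K x y * f y * (K x y * g y) = D * ∑ y, f y * g y := by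
    rw [Finset.sum_comm, Finset.mul_sum]
    refine Finset.sum_congr rfl fun y _ => ?_
    rw [← h.degree_symm y, Finset.sum_mul]
    exact Finset.sum_congr rfl fun x _ => by rw [mul_mul_mul_comm, h.mul_self]
  rw [Finset.sum_congr rfl fun x _ => sum_mul_sum_eq_sum_add_sum_offDiag Finset.univ
    (fun y => K x y * f y) fun z => K x z * g z, Finset.sum_add_distrib, hdiag]
  exact add_le_add_right (h.sum_sum_offDiag_le hf hg) _

theorem moments (h : IsCircleKernel K q D) {r : V → ℝ} (hr : 0 ≤ r)
    (hsum : ∑ x, r x ^ 3 ≤ q ^ 2) :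
    ∑ x, r x ^ 2 ≤ q ^ 2 ∧ ∑ x, r x ^ 4 ≤ q ^ 3 ∧ ∑ x, r x ^ 6 ≤ q ^ 4 := by
  have hq := h.pos.le
  have h3 (x : V) : r x ^ 3 ≤ q ^ 2 :=
    (Finset.single_le_sum (f := fun x => r x ^ 3) (fun i _ => pow_nonneg (hr i) 3)
      (Finset.mem_univ x)).trans hsum
  have h1 (x : V) : r x ≤ q := le_of_pow_le_pow_left₀ three_ne_zero hq
    ((h3 x).trans (pow_le_pow_right₀ h.one_le (by norm_num)))
  refine ⟨?_, ?_, ?_⟩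
  · calc ∑ x, r x ^ 2 ≤ ∑ x, (2 / 3 * r x ^ 3 + 1 / 3) := by
          refine Finset.sum_le_sum fun x _ => ?_
          have hrx : 0 ≤ r x := hr x
          nlinarith [mul_nonneg (sq_nonneg (r x - 1)) (by linarith : 0 ≤ 2 * r x + 1)]
      _ = 2 / 3 * ∑ x, r x ^ 3 + q ^ 2 * (1 / 3) := by
          rw [Finset.sum_add_distrib, Finset.mul_sum]
          simp [h.card]
      _ ≤ q ^ 2 := by linarith
  · calc ∑ x, r x ^ 4 ≤ ∑ x, q * r x ^ 3 := by
          refine Finset.sum_le_sum fun x _ => ?_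
          rw [pow_succ']
          exact mul_le_mul_of_nonneg_right (h1 x) (pow_nonneg (hr x) 3)
      _ = q * ∑ x, r x ^ 3 := by rw [Finset.mul_sum]
      _ ≤ q * q ^ 2 := by gcongr
      _ = q ^ 3 := by ring
  · calc ∑ x, r x ^ 6 = ∑ x, r x ^ 3 * r x ^ 3 := Finset.sum_congr rfl fun x _ => by ring
      _ ≤ ∑ x, q ^ 2 * r x ^ 3 := Finset.sum_le_sum fun x _ =>
          mul_le_mul_of_nonneg_right (h3 x) (pow_nonneg (hr x) 3)
      _ = q ^ 2 * ∑ x, r x ^ 3 := by rw [Finset.mul_sum]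
      _ ≤ q ^ 2 * q ^ 2 := by gcongr
      _ = q ^ 4 := by ring

theorem sum_pow_three_le (h : IsCircleKernel K q D) {r : V → ℝ} (hr : 0 ≤ r)
    (hsum : ∑ x, r x ^ 3 ≤ q ^ 2) :
    ∑ x, (∑ y, K x y * r y ^ 2) ^ 3 ≤ 20 * q ^ 5 := by
  obtain ⟨h2, h4, h6⟩ := h.moments hr hsum
  have hq := h.pos
  have hD := h.degree_pos
  have hr' (k : ℕ) : (0 : V → ℝ) ≤ fun y => r y ^ k := fun y => pow_nonneg (hr y) k
  have hr₃ : 0 ≤ ∑ y, r y ^ 3 := Finset.sum_nonneg fun y _ => hr' 3 y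
  have hnear := h.sum_sum_mul_sum_le (hr' 2) (hr' 4)
  have hfar := h.sum_sum_offDiag_le (hr' 3) (hr' 3)
  calc ∑ x, (∑ y, K x y * r y ^ 2) ^ 3
      ≤ ∑ x, (2 * ((∑ y, K x y * r y ^ 2) * ∑ y, K x y * r y ^ 4) +
          3 * (D * ∑ p ∈ Finset.univ.offDiag, K x p.1 * r p.1 ^ 3 * (K x p.2 * r p.2 ^ 3))) := by
        refine Finset.sum_le_sum fun x _ => ?_
        simpa only [← mul_assoc, h.mul_self, h.degree] using pow_three_sum_sq_le (h.nonneg x) hr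
    _ = 2 * (∑ x, (∑ y, K x y * r y ^ 2) * ∑ y, K x y * r y ^ 4) +
        3 * (D * ∑ x, ∑ p ∈ Finset.univ.offDiag,
          K x p.1 * r p.1 ^ 3 * (K x p.2 * r p.2 ^ 3)) := by
        simp only [Finset.sum_add_distrib, Finset.mul_sum]
    _ ≤ 2 * (D * (∑ y, r y ^ 2 * r y ^ 4) + 2 * ((∑ y, r y ^ 2) * ∑ y, r y ^ 4)) +
        3 * (D * (2 * ((∑ y, r y ^ 3) * ∑ y, r y ^ 3))) := by gcongr
    _ ≤ 2 * (2 * q * q ^ 4 + 2 * (q ^ 2 * q ^ 3)) + 3 * (2 * q * (2 * (q ^ 2 * q ^ 2))) := by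
        have h6' : ∑ y, r y ^ 2 * r y ^ 4 ≤ q ^ 4 := by simpa only [← pow_add] using h6
        gcongr
        exacts [h.degree_le, h.degree_le]
    _ = 20 * q ^ 5 := by ring

theorem sum_div (h : IsCircleKernel K q D) (x : V) : ∑ y, K x y / D = 1 := by
  rw [← Finset.sum_div, h.degree, div_self h.degree_pos.ne']

theorem div_nonneg' (h : IsCircleKernel K q D) (x y : V) : 0 ≤ K x y / D :=
  div_nonneg (h.nonneg x y) h.degree_pos.le

theorem average_nonneg (h : IsCircleKernel K q D) {f : V → ℝ} (hf : 0 ≤ f) (x : V) :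
    0 ≤ ∑ y, K x y / D * f y :=
  Finset.sum_nonneg fun y _ => mul_nonneg (h.div_nonneg' x y) (hf y)

theorem isDensity_average (h : IsCircleKernel K q D) {ψ : V → ℝ} (hψ : IsDensity ψ) :
    IsDensity fun x => ∑ y, K x y / D * ψ y := by
  refine ⟨h.average_nonneg hψ.1, ?_⟩
  rw [Finset.sum_comm]
  refine le_of_eq_of_le (Finset.sum_congr rfl fun y _ => ?_) hψ.2
  rw [← Finset.sum_mul, ← Finset.sum_div, h.degree_symm, div_self h.degree_pos.ne', one_mul]

theorem average_rpow_le (h : IsCircleKernel K q D) {ψ : V → ℝ} (hψ : 0 ≤ ψ) {a : ℝ}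
    (ha : 0 < a) (ha1 : a ≤ 1) (x : V) :
    ∑ y, K x y / D * ψ y ^ a ≤ (∑ y, K x y / D * ψ y) ^ a := by
  have hψa : (0 : V → ℝ) ≤ fun y => ψ y ^ a := fun y => Real.rpow_nonneg (hψ y) a
  have hjensen := Real.rpow_arith_mean_le_arith_mean_rpow Finset.univ (fun y => K x y / D)
    (fun y => ψ y ^ a) (fun y _ => h.div_nonneg' x y) (h.sum_div x) (fun y _ => hψa y)
    (p := a⁻¹) ((one_le_inv₀ ha).2 ha1)
  simp only [Real.rpow_rpow_inv (hψ _) ha.ne'] at hjensen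
  exact (Real.rpow_inv_le_iff_of_pos (h.average_nonneg hψa x) (h.average_nonneg hψ x) ha).1 hjensen

theorem sum_average_rpow_pow_three_le (h : IsCircleKernel K q D) {ψ : V → ℝ} (hψ : IsDensity ψ) :
    ∑ x, (∑ y, K x y / D * ψ y ^ (2 / 3 : ℝ)) ^ 3 ≤ 540 * q ^ 2 := by
  have hD := h.degree_pos
  have hroot (k : ℕ) (y : V) : (ψ y ^ (1 / 3 : ℝ)) ^ k = ψ y ^ (k / 3 : ℝ) := by
    rw [← Real.rpow_natCast, ← Real.rpow_mul (hψ.1 y), one_div_mul_eq_div]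
  have hcube := h.sum_pow_three_le (r := fun y => ψ y ^ (1 / 3 : ℝ))
    (fun y => Real.rpow_nonneg (hψ.1 y) _) (by
      simpa only [hroot, Nat.cast_ofNat, div_self (three_ne_zero' ℝ), Real.rpow_one, h.card]
        using hψ.2)
  calc ∑ x, (∑ y, K x y / D * ψ y ^ (2 / 3 : ℝ)) ^ 3
      = (∑ x, (∑ y, K x y * (ψ y ^ (1 / 3 : ℝ)) ^ 2) ^ 3) / D ^ 3 := by
        simp only [hroot, Nat.cast_ofNat, div_mul_eq_mul_div, ← Finset.sum_div, div_pow]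
    _ ≤ 20 * q ^ 5 / D ^ 3 := by gcongr
    _ ≤ 540 * q ^ 2 := by
        rw [div_le_iff₀ (by positivity)]
        calc 20 * q ^ 5 = 20 * q ^ 2 * q ^ 3 := by ring
          _ ≤ 20 * q ^ 2 * (3 * D) ^ 3 := by gcongr; exacts [h.pos.le, h.le_degree]
          _ = 540 * q ^ 2 * D ^ 3 := by ring

theorem isDensity_edge (h : IsCircleKernel K q D) {φ ψ : V → ℝ} (hφ : IsDensity φ)
    (hψ : IsDensity ψ) : IsDensity fun x =>
      φ x ^ (2 / 3 : ℝ) * (∑ y, K x y / D * ψ y ^ (2 / 3 : ℝ)) / 200 := by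
  have hA := h.average_nonneg (f := fun y => ψ y ^ (2 / 3 : ℝ)) fun y =>
    Real.rpow_nonneg (hψ.1 y) _
  refine ⟨fun x => div_nonneg (mul_nonneg (Real.rpow_nonneg (hφ.1 x) _) (hA x)) (by norm_num), ?_⟩
  have hyoung (x : V) : φ x ^ (2 / 3 : ℝ) * (∑ y, K x y / D * ψ y ^ (2 / 3 : ℝ)) ≤
      2 / 3 * φ x + 1 / 3 * (∑ y, K x y / D * ψ y ^ (2 / 3 : ℝ)) ^ 3 := by
    have := Real.geom_mean_le_arith_mean2_weighted (w₁ := 2 / 3) (w₂ := 1 / 3) (by norm_num)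
      (by norm_num) (hφ.1 x) (pow_nonneg (hA x) 3) (by norm_num)
    have hroot : ((∑ y, K x y / D * ψ y ^ (2 / 3 : ℝ)) ^ 3) ^ (1 / 3 : ℝ) =
        ∑ y, K x y / D * ψ y ^ (2 / 3 : ℝ) := by
      simpa using Real.pow_rpow_inv_natCast (hA x) three_ne_zero
    rwa [hroot] at this
  rw [← Finset.sum_div, div_le_iff₀ (by norm_num), h.card]
  calc _ ≤ ∑ x, (2 / 3 * φ x + 1 / 3 * (∑ y, K x y / D * ψ y ^ (2 / 3 : ℝ)) ^ 3) :=
        Finset.sum_le_sum fun x _ => hyoung x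
    _ = 2 / 3 * ∑ x, φ x + 1 / 3 * ∑ x, (∑ y, K x y / D * ψ y ^ (2 / 3 : ℝ)) ^ 3 := by
        rw [Finset.sum_add_distrib, ← Finset.mul_sum, ← Finset.mul_sum]
    _ ≤ q ^ 2 * 200 := by
        linarith [hφ.2.trans_eq h.card, h.sum_average_rpow_pow_three_le hψ, sq_nonneg q]

theorem exists_isDensity_edge (h : IsCircleKernel K q D) {φ ψ : V → ℝ} (hφ : IsDensity φ)
    (hψ : IsDensity ψ) {a : ℝ} (ha : 0 < a) (ha' : a ≤ 2 / 3) :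
    ∃ χ : V → ℝ, IsDensity χ ∧
      ∀ x, φ x ^ a * ∑ y, K x y / D * ψ y ^ a ≤ 200 * χ x ^ (3 / 2 * a) := by
  refine ⟨_, h.isDensity_edge hφ hψ, fun x => ?_⟩
  set b := 3 / 2 * a with hb
  have hψ' : (0 : V → ℝ) ≤ fun y => ψ y ^ (2 / 3 : ℝ) := fun y => Real.rpow_nonneg (hψ.1 y) _
  have hb0 : 0 < b := by positivity
  have hb1 : b ≤ 1 := by linarith
  have hφx : 0 ≤ φ x ^ (2 / 3 : ℝ) := Real.rpow_nonneg (hφ.1 x) _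
  have hA := h.average_nonneg hψ' x
  have hab : a = 2 / 3 * b := by rw [hb]; ring
  calc φ x ^ a * ∑ y, K x y / D * ψ y ^ a
      = (φ x ^ (2 / 3 : ℝ)) ^ b * ∑ y, K x y / D * (ψ y ^ (2 / 3 : ℝ)) ^ b := by
        simp only [hab, Real.rpow_mul (hφ.1 x), Real.rpow_mul (hψ.1 _)]
    _ ≤ (φ x ^ (2 / 3 : ℝ)) ^ b * (∑ y, K x y / D * ψ y ^ (2 / 3 : ℝ)) ^ b :=
        mul_le_mul_of_nonneg_left (h.average_rpow_le hψ' hb0 hb1 x) (Real.rpow_nonneg hφx b)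
    _ = (200 : ℝ) ^ b * (φ x ^ (2 / 3 : ℝ) * (∑ y, K x y / D * ψ y ^ (2 / 3 : ℝ)) / 200) ^ b := by
        rw [← Real.mul_rpow (by norm_num) (div_nonneg (mul_nonneg hφx hA) (by norm_num)),
          mul_div_cancel₀ _ (by norm_num), Real.mul_rpow hφx hA]
    _ ≤ 200 * (φ x ^ (2 / 3 : ℝ) * (∑ y, K x y / D * ψ y ^ (2 / 3 : ℝ)) / 200) ^ b :=
        mul_le_mul_of_nonneg_right (Real.rpow_le_self_of_one_le (by norm_num) hb1) (by positivity)

end IsCircleKernel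

theorem sum_fin_succ_arrow {V M : Type*} [Fintype V] [AddCommMonoid M] {n : ℕ}
    (g : (Fin (n + 1) → V) → M) :
    ∑ x, g x = ∑ x : Fin n → V, ∑ y, g (Fin.snoc x y) := by
  rw [Finset.sum_comm, ← Fintype.sum_prod_type']
  exact (Fintype.sum_equiv (Fin.snocEquiv fun _ => V) _ _ fun _ => rfl).symm

theorem PowerBound.nonneg {ι V : Type*} [Fintype ι] [DecidableEq ι] [Fintype V]
    {w : (ι → V) → ℝ} (hw : 0 ≤ w) {a : ι → ℝ} {C : ℝ} (h : PowerBound w a C) : 0 ≤ C :=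
  (Finset.sum_nonneg fun x _ => mul_nonneg (hw x) (Finset.prod_nonneg fun _ _ =>
    Real.rpow_nonneg zero_le_one _)).trans (h _ fun _ => isDensity_one)

theorem PowerBound.of_sum_snoc_le {V : Type*} [Fintype V] {n : ℕ} {w : (Fin (n + 1) → V) → ℝ}
    {w' : (Fin n → V) → ℝ} {s : Finset (Fin n)} {c C : ℝ}
    (h : PowerBound w' (vertexExponent s) C) (hc : 0 ≤ c)
    (hw : ∀ x, ∑ y, w (Fin.snoc x y) ≤ c * w' x) :
    PowerBound w (vertexExponent (s.map Fin.castSuccEmb)) (c * C) := by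
  intro φ hφ
  have hcast (i : Fin n) :
      vertexExponent (s.map Fin.castSuccEmb) i.castSucc = vertexExponent s i := by
    simp [vertexExponent]
  have hlast : vertexExponent (s.map Fin.castSuccEmb) (Fin.last n) = 0 := by
    simp [vertexExponent, Fin.castSucc_ne_last]
  calc ∑ x, w x * ∏ i, φ i (x i) ^ vertexExponent (s.map Fin.castSuccEmb) i
      = ∑ x : Fin n → V, (∑ y, w (Fin.snoc x y)) *
          ∏ i, φ i.castSucc (x i) ^ vertexExponent s i := by
        simp only [sum_fin_succ_arrow, Fin.prod_univ_castSucc, Fin.snoc_castSucc, hcast, hlast,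
          Real.rpow_zero, mul_one, Finset.sum_mul]
    _ ≤ ∑ x : Fin n → V, c * w' x * ∏ i, φ i.castSucc (x i) ^ vertexExponent s i :=
        Finset.sum_le_sum fun x _ => mul_le_mul_of_nonneg_right (hw x) <|
          Finset.prod_nonneg fun i _ => Real.rpow_nonneg ((hφ _).1 _) _
    _ = c * ∑ x : Fin n → V, w' x * ∏ i, φ i.castSucc (x i) ^ vertexExponent s i := by
        simp only [Finset.mul_sum, mul_assoc]
    _ ≤ c * C := mul_le_mul_of_nonneg_left (h _ fun i => hφ i.castSucc) hc

section AttachLeaf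

variable {V : Type*} {n : ℕ}

/-- The weight obtained by joining a new vertex to the vertex `v` with the kernel `k`. -/
def attachLeaf (k : V → V → ℝ) (w : (Fin n → V) → ℝ) (v : Fin n) (x : Fin (n + 1) → V) : ℝ :=
  w (fun i => x i.castSucc) * k (x v.castSucc) (x (Fin.last n))

variable [Fintype V] {w : (Fin n → V) → ℝ} (v : Fin n) {C : ℝ}

theorem powerBound_attachLeaf {k : V → V → ℝ} (hw : 0 ≤ w) {a : Fin (n + 1) → ℝ}
    {a' : Fin n → ℝ} {c : ℝ} (hc : 0 ≤ c) (ha : ∀ i, i ≠ v → a i.castSucc = a' i)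
    (hχ : ∀ φ ψ : V → ℝ, IsDensity φ → IsDensity ψ → ∃ χ : V → ℝ, IsDensity χ ∧
      ∀ x, φ x ^ a v.castSucc * ∑ y, k x y * ψ y ^ a (Fin.last n) ≤ c * χ x ^ a' v)
    (h : PowerBound w a' C) : PowerBound (attachLeaf k w v) a (c * C) := by
  intro φ hφ
  obtain ⟨χ, hχd, hχ⟩ := hχ _ _ (hφ v.castSucc) (hφ (Fin.last n))
  let φ' := Function.update (fun i => φ i.castSucc) v χ
  have hφ' (i : Fin n) : IsDensity (φ' i) := by
    rcases eq_or_ne i v with rfl | hi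
    · simpa [φ'] using hχd
    · simpa [φ', hi] using hφ i.castSucc
  let P (x : Fin n → V) := ∏ i ∈ Finset.univ.erase v, φ i.castSucc (x i) ^ a i.castSucc
  have hP (x : Fin n → V) : 0 ≤ P x :=
    Finset.prod_nonneg fun i _ => Real.rpow_nonneg ((hφ _).1 _) _
  have hprod (x : Fin n → V) : ∏ i, φ' i (x i) ^ a' i = χ (x v) ^ a' v * P x := by
    rw [← Finset.mul_prod_erase _ _ (Finset.mem_univ v)]
    congr 1
    · simp [φ']
    · refine Finset.prod_congr rfl fun i hi => ?_
      simp [φ', Finset.ne_of_mem_erase hi, ha i (Finset.ne_of_mem_erase hi)]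
  calc ∑ x, attachLeaf k w v x * ∏ i, φ i (x i) ^ a i
      = ∑ x : Fin n → V, w x * P x * (φ v.castSucc (x v) ^ a v.castSucc *
          ∑ y, k (x v) y * φ (Fin.last n) y ^ a (Fin.last n)) := by
        simp only [sum_fin_succ_arrow, Finset.mul_sum, attachLeaf, Fin.prod_univ_castSucc,
          Fin.snoc_castSucc, Fin.snoc_last]
        refine Finset.sum_congr rfl fun x _ => Finset.sum_congr rfl fun y _ => ?_
        rw [← Finset.mul_prod_erase _ _ (Finset.mem_univ v)]
        ring
    _ ≤ ∑ x : Fin n → V, w x * P x * (c * χ (x v) ^ a' v) :=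
        Finset.sum_le_sum fun x _ =>
          mul_le_mul_of_nonneg_left (hχ _) (mul_nonneg (hw x) (hP x))
    _ = c * ∑ x : Fin n → V, w x * ∏ i, φ' i (x i) ^ a' i := by
        rw [Finset.mul_sum]
        exact Finset.sum_congr rfl fun x _ => by rw [hprod]; ring
    _ ≤ c * C := mul_le_mul_of_nonneg_left (h φ' hφ') hc

theorem exists_eq_map_castSucc (s : Finset (Fin (n + 1))) : ∃ s' : Finset (Fin n),
    s = s'.map Fin.castSuccEmb ∨ s = insert (Fin.last n) (s'.map Fin.castSuccEmb) := by
  refine ⟨Finset.univ.filter fun i => i.castSucc ∈ s, ?_⟩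
  by_cases hs : Fin.last n ∈ s
  · refine .inr (Finset.ext (Fin.lastCases (by simp [hs]) fun i => ?_))
    simp [Fin.castSucc_ne_last]
  · refine .inl (Finset.ext (Fin.lastCases (by simp [hs, Fin.castSucc_ne_last]) fun i => ?_))
    simp

theorem card_insert_last_map (s : Finset (Fin n)) :
    (insert (Fin.last n) (s.map Fin.castSuccEmb)).card = s.card + 1 := by
  rw [Finset.card_insert_of_notMem (by simp [Fin.castSucc_ne_last]), Finset.card_map]

theorem vertexExponent_insert_last (s : Finset (Fin n)) :
    vertexExponent (insert (Fin.last n) (s.map Fin.castSuccEmb)) (Fin.last n) =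
      2 / (s.card + 2) := by
  simp only [vertexExponent, card_insert_last_map, Finset.mem_insert_self, if_true]
  push_cast
  ring

theorem vertexExponent_insert_castSucc (s : Finset (Fin n)) (i : Fin n) :
    vertexExponent (insert (Fin.last n) (s.map Fin.castSuccEmb)) i.castSucc =
      if i ∈ s then 2 / (s.card + 2 : ℝ) else 0 := by
  simp only [vertexExponent, card_insert_last_map, Finset.mem_insert, Fin.castSucc_ne_last,
    Finset.mem_map, Fin.castSuccEmb_apply, Fin.castSucc_inj, exists_eq_right, false_or]
  push_cast
  ring_nf

variable {K : V → V → ℝ} {q D : ℝ} (h : IsCircleKernel K q D)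

include h

theorem powerBound_attachLeaf_map {s : Finset (Fin n)}
    (hs : PowerBound w (vertexExponent s) C) :
    PowerBound (attachLeaf (fun x y => K x y / D) w v)
      (vertexExponent (s.map Fin.castSuccEmb)) C := by
  rw [← one_mul C]
  refine hs.of_sum_snoc_le zero_le_one fun x => le_of_eq ?_
  simp only [attachLeaf, Fin.snoc_castSucc, Fin.snoc_last, ← Finset.mul_sum, h.sum_div, mul_one,
    one_mul]

theorem powerBound_attachLeaf_insert_of_notMem (hw : 0 ≤ w) {s : Finset (Fin n)} (hv : v ∉ s)
    (hs : PowerBound w (vertexExponent (insert v s)) C) :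
    PowerBound (attachLeaf (fun x y => K x y / D) w v)
      (vertexExponent (insert (Fin.last n) (s.map Fin.castSuccEmb))) C := by
  have hexp (i : Fin n) :
      vertexExponent (insert v s) i = if i = v ∨ i ∈ s then 2 / (s.card + 2 : ℝ) else 0 := by
    simp only [vertexExponent, Finset.mem_insert, Finset.card_insert_of_notMem hv]
    push_cast
    ring_nf
  rw [← one_mul C]
  refine powerBound_attachLeaf v hw zero_le_one (fun i hi => ?_)
    (fun φ ψ _ hψ => ⟨_, h.isDensity_average hψ, fun x => ?_⟩) hs
  · simp [vertexExponent_insert_castSucc, hexp, hi]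
  · rw [vertexExponent_insert_castSucc, if_neg hv, Real.rpow_zero, one_mul, one_mul,
      vertexExponent_insert_last, hexp, if_pos (.inl rfl)]
    exact h.average_rpow_le hψ.1 (by positivity) (by rw [div_le_one (by positivity)]; linarith) x

theorem powerBound_attachLeaf_insert_of_mem (hw : 0 ≤ w) {s : Finset (Fin n)} (hv : v ∈ s)
    (hcard : s.card ≤ 2) (hvert : PowerBound w (vertexExponent {v}) C)
    (hs : PowerBound w (vertexExponent s) C) :
    PowerBound (attachLeaf (fun x y => K x y / D) w v)
      (vertexExponent (insert (Fin.last n) (s.map Fin.castSuccEmb))) (200 * C) := by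
  have hconv := (convex_powerBound hw C ⟨vertexExponent_nonneg {v}, hvert⟩
    ⟨vertexExponent_nonneg s, hs⟩ (by norm_num : (0 : ℝ) ≤ 1 / 4)
    (by norm_num : (0 : ℝ) ≤ 3 / 4) (by norm_num)).2
  have hpos : 0 < s.card := Finset.card_pos.2 ⟨v, hv⟩
  refine powerBound_attachLeaf v hw (by norm_num) (fun i hi => ?_) (fun φ ψ hφ hψ => ?_) hconv
  · rw [vertexExponent_insert_castSucc]
    by_cases his : i ∈ s
    · have h2 : s.card = 2 :=
        hcard.antisymm (Finset.one_lt_card.2 ⟨i, his, v, hv, hi⟩)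
      simp only [his, h2, Pi.add_apply, Pi.smul_apply, vertexExponent, Finset.mem_singleton, hi]
      norm_num
    · simp [vertexExponent, hi, his]
  · have hv' : ((1 / 4 : ℝ) • vertexExponent {v} + (3 / 4 : ℝ) • vertexExponent s) v =
        3 / 2 * (2 / (s.card + 2)) := by
      obtain h1 | h2 : s.card = 1 ∨ s.card = 2 := by omega
      · simp only [Pi.add_apply, Pi.smul_apply, vertexExponent, Finset.mem_singleton, hv, h1]
        norm_num
      · simp only [Pi.add_apply, Pi.smul_apply, vertexExponent, Finset.mem_singleton, hv, h2]
        norm_num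
    rw [vertexExponent_insert_castSucc, if_pos hv, vertexExponent_insert_last, hv']
    refine h.exists_isDensity_edge hφ hψ (by positivity) ?_
    have : (1 : ℝ) ≤ s.card := by exact_mod_cast hpos
    rw [div_le_div_iff₀ (by positivity) (by positivity)]
    linarith

theorem VertexBound.attachLeaf (hw : 0 ≤ w) (hC : VertexBound w C) :
    VertexBound (attachLeaf (fun x y => K x y / D) w v) (200 * C) := by
  intro s hs
  have hC₀ : 0 ≤ C := (hC ∅ (by simp)).nonneg hw
  have hC₁ : C ≤ 200 * C := by linarith
  obtain ⟨s, rfl | rfl⟩ := exists_eq_map_castSucc s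
  · rw [Finset.card_map] at hs
    exact (powerBound_attachLeaf_map v h (hC s hs)).mono hC₁
  · rw [card_insert_last_map] at hs
    by_cases hv : v ∈ s
    · exact powerBound_attachLeaf_insert_of_mem v h hw hv (by omega) (hC _ (by simp))
        (hC s (by omega))
    · exact (powerBound_attachLeaf_insert_of_notMem v h hw hv
        (hC _ ((Finset.card_insert_le v s).trans hs))).mono hC₁

end AttachLeaf

section GraphWeight

variable {V : Type*} {m n : ℕ}

open Classical in
/-- The product of `K (xⁱ, xʲ)` over the edges `{i, j}` of `G`, each edge being counted once, as
the pair `(i, j)` with `i < j`. -/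
noncomputable def edgeProduct (K : V → V → ℝ) (G : SimpleGraph (Fin n)) (x : Fin n → V) : ℝ :=
  ∏ e : Fin n × Fin n with e.1 < e.2 ∧ G.Adj e.1 e.2, K (x e.1) (x e.2)

/-- The edge product normalized to total mass one, so that `Λ_G` is the multilinear form with
this weight. -/
noncomputable def graphWeight (K : V → V → ℝ) [Fintype V] (G : SimpleGraph (Fin n))
    (x : Fin n → V) : ℝ :=
  edgeProduct K G x / ∑ y, edgeProduct K G y

/-- `G` arises from `G₀` by joining one new vertex, the last one, to the vertices in `s`. -/
structure IsVertexExtension (G₀ : SimpleGraph (Fin n)) (G : SimpleGraph (Fin (n + 1)))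
    (s : Finset (Fin n)) : Prop where
  adj_castSucc : ∀ i j : Fin n, G.Adj i.castSucc j.castSucc ↔ G₀.Adj i j
  adj_last : ∀ i : Fin n, G.Adj i.castSucc (Fin.last n) ↔ i ∈ s

theorem edgeProduct_eq_prod_prod (K : V → V → ℝ) (G : SimpleGraph (Fin n)) [DecidableRel G.Adj]
    (x : Fin n → V) :
    edgeProduct K G x = ∏ i, ∏ j, if i < j ∧ G.Adj i j then K (x i) (x j) else 1 := by
  rw [edgeProduct, Finset.prod_filter, Fintype.prod_prod_type]
  congr!

theorem IsVertexExtension.edgeProduct_snoc {G₀ : SimpleGraph (Fin n)}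
    {G : SimpleGraph (Fin (n + 1))} {s : Finset (Fin n)} (hG : IsVertexExtension G₀ G s)
    (K : V → V → ℝ) (x : Fin n → V) (y : V) :
    edgeProduct K G (Fin.snoc x y) = edgeProduct K G₀ x * ∏ i ∈ s, K (x i) y := by
  classical
  simp only [edgeProduct_eq_prod_prod, Fin.prod_univ_castSucc, Fin.castSucc_lt_castSucc_iff,
    hG.adj_castSucc, hG.adj_last, Fin.castSucc_lt_last, Fin.snoc_castSucc, Fin.snoc_last,
    Finset.prod_mul_distrib, Finset.prod_ite_mem, Finset.univ_inter, true_and]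
  simp [Fin.not_lt.2 (Fin.le_last _)]

variable {K : V → V → ℝ} {G : SimpleGraph (Fin n)}

theorem edgeProduct_eq_ite (h01 : ∀ x y, K x y = 0 ∨ K x y = 1) (hsymm : ∀ x y, K x y = K y x)
    (x : Fin n → V) [Decidable (∀ i j, G.Adj i j → K (x i) (x j) = 1)] :
    edgeProduct K G x = if ∀ i j, G.Adj i j → K (x i) (x j) = 1 then 1 else 0 := by
  split_ifs with hx
  · refine Finset.prod_eq_one fun e he => ?_
    classical exact hx _ _ (Finset.mem_filter.1 he).2.2
  · obtain ⟨i, j, hij, hne⟩ : ∃ i j, G.Adj i j ∧ K (x i) (x j) ≠ 1 := by push Not at hx; exact hx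
    have hzero := (h01 (x i) (x j)).resolve_right hne
    rcases lt_or_gt_of_ne hij.ne with hlt | hlt
    · exact Finset.prod_eq_zero (i := (i, j)) (by simp [hlt, hij]) hzero
    · exact Finset.prod_eq_zero (i := (j, i)) (by simp [hlt, hij.symm]) (by rw [hsymm, hzero])

theorem edgeProduct_comp_iso (h01 : ∀ x y, K x y = 0 ∨ K x y = 1)
    (hsymm : ∀ x y, K x y = K y x) {G' : SimpleGraph (Fin m)} (e : G ≃g G') (x : Fin m → V) :
    edgeProduct K G (x ∘ e) = edgeProduct K G' x := by
  classical
  rw [edgeProduct_eq_ite h01 hsymm, edgeProduct_eq_ite h01 hsymm]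
  refine if_congr ⟨fun hx i j hij => ?_, fun hx i j hij => hx _ _ (e.map_adj_iff.2 hij)⟩ rfl rfl
  simpa using hx (e.symm i) (e.symm j) (e.symm.map_adj_iff.2 hij)

variable [Fintype V]

theorem sum_edgeProduct_iso (h01 : ∀ x y, K x y = 0 ∨ K x y = 1) (hsymm : ∀ x y, K x y = K y x)
    {G' : SimpleGraph (Fin m)} (e : G ≃g G') :
    ∑ x, edgeProduct K G x = ∑ x, edgeProduct K G' x :=
  (Fintype.sum_equiv (e.toEquiv.symm.arrowCongr (Equiv.refl V)) _ _ fun x =>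
    (edgeProduct_comp_iso h01 hsymm e x).symm).symm

theorem graphWeight_comp_iso (h01 : ∀ x y, K x y = 0 ∨ K x y = 1)
    (hsymm : ∀ x y, K x y = K y x) {G' : SimpleGraph (Fin m)} (e : G ≃g G') (x : Fin m → V) :
    graphWeight K G (x ∘ e) = graphWeight K G' x := by
  rw [graphWeight, graphWeight, edgeProduct_comp_iso h01 hsymm, sum_edgeProduct_iso h01 hsymm e]

theorem vertexBound_point (K : V → V → ℝ) :
    VertexBound (graphWeight K (⊥ : SimpleGraph (Fin 1))) 1 := by
  intro s _ φ hφ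
  have hexp : vertexExponent s 0 = 1 ∨ vertexExponent s 0 = 0 := by
    by_cases hs : 0 ∈ s
    · have hcard : s.card = 1 :=
        le_antisymm (card_finset_fin_le s) (Finset.card_pos.2 ⟨0, hs⟩)
      norm_num [vertexExponent, hs, hcard]
    · simp [vertexExponent, hs]
  have hsum : ∑ x : V, φ 0 x ^ vertexExponent s 0 ≤ Fintype.card V := by
    rcases hexp with he | he
    · simpa only [he, Real.rpow_one] using (hφ 0).2
    · simp [he]
  calc ∑ x : Fin 1 → V, graphWeight K ⊥ x * ∏ i, φ i (x i) ^ vertexExponent s i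
      = (∑ x : V, φ 0 x ^ vertexExponent s 0) / Fintype.card V := by
        rw [Finset.sum_div, ← (Equiv.funUnique (Fin 1) V).sum_comp]
        simp [graphWeight, edgeProduct, inv_mul_eq_div]
    _ ≤ 1 := div_le_one_of_le₀ hsum (Nat.cast_nonneg _)

namespace IsCircleKernel

variable {q D C : ℝ} (h : IsCircleKernel K q D)

include h

theorem edgeProduct_nonneg (x : Fin n → V) : 0 ≤ edgeProduct K G x :=
  Finset.prod_nonneg fun _ _ => h.nonneg _ _

theorem graphWeight_nonneg : 0 ≤ graphWeight K G := fun x =>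
  div_nonneg (h.edgeProduct_nonneg x) (Finset.sum_nonneg fun y _ => h.edgeProduct_nonneg y)

theorem vertexBound_iso {G' : SimpleGraph (Fin m)} (e : G ≃g G')
    (hC : VertexBound (graphWeight K G) C) : VertexBound (graphWeight K G') C := by
  refine VertexBound.reindex e.toEquiv ?_
  convert hC using 2 with x
  exact graphWeight_comp_iso h.zero_or_one h.symm e.symm x

theorem sum_edgeProduct_leaf {G' : SimpleGraph (Fin (n + 1))} {v : Fin n}
    (hG : IsVertexExtension G G' {v}) :
    ∑ x, edgeProduct K G' x = (∑ x, edgeProduct K G x) * D := by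
  simp only [sum_fin_succ_arrow, hG.edgeProduct_snoc, Finset.prod_singleton, ← Finset.mul_sum,
    h.degree, Finset.sum_mul]

theorem graphWeight_leaf {G' : SimpleGraph (Fin (n + 1))} {v : Fin n}
    (hG : IsVertexExtension G G' {v}) :
    graphWeight K G' = attachLeaf (fun x y => K x y / D) (graphWeight K G) v := by
  ext x
  obtain ⟨x, y, rfl⟩ : ∃ (x' : Fin n → V) (y : V), x = Fin.snoc x' y :=
    ⟨_, _, (Fin.snoc_init_self x).symm⟩
  simp only [graphWeight, attachLeaf, h.sum_edgeProduct_leaf hG, hG.edgeProduct_snoc,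
    Finset.prod_singleton, Fin.snoc_castSucc, Fin.snoc_last, div_mul_div_comm]

theorem vertexBound_leaf {G' : SimpleGraph (Fin (n + 1))} {v : Fin n}
    (hG : IsVertexExtension G G' {v}) (hC : VertexBound (graphWeight K G) C) :
    VertexBound (graphWeight K G') (200 * C) := by
  rw [h.graphWeight_leaf hG]
  exact hC.attachLeaf v h h.graphWeight_nonneg

end IsCircleKernel

end GraphWeight

theorem four_mul_card_filter_mem_notMem {V : Type*} [Fintype V] [DecidableEq V] {y z : V}
    (hyz : y ≠ z) :
    4 * (Finset.univ.filter fun s : Finset V => y ∈ s ∧ z ∉ s).card = 2 ^ Fintype.card V := by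
  have hIcc : (Finset.univ.filter fun s : Finset V => y ∈ s ∧ z ∉ s) = Finset.Icc {y} {z}ᶜ := by
    ext s
    simp
  have hcard : 2 ≤ Fintype.card V := by
    simpa [hyz] using Finset.card_le_univ ({y, z} : Finset V)
  rw [hIcc, Finset.card_Icc_finset (by simpa using hyz.symm), Finset.card_compl,
    Finset.card_singleton, Finset.card_singleton, show (4 : ℕ) = 2 ^ 2 from rfl, ← pow_add]
  congr 1
  omega

theorem sum_sum_le_of_forall_sum_compl_le {V : Type*} [Fintype V] [DecidableEq V]
    {B : V → V → ℝ} {M : ℝ} (hB : ∀ y, B y y = 0)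
    (h : ∀ s : Finset V, ∑ y ∈ s, ∑ z ∈ sᶜ, B y z ≤ M) : ∑ y, ∑ z, B y z ≤ 4 * M := by
  have hcount (y z : V) : ∑ s : Finset V, (if y ∈ s ∧ z ∉ s then B y z else 0) =
      2 ^ Fintype.card V / 4 * B y z := by
    rcases eq_or_ne y z with rfl | hyz
    · simp [hB]
    · rw [← Finset.sum_filter, Finset.sum_const, nsmul_eq_mul,
        ← Nat.cast_ofNat (R := ℝ) (n := 2), ← Nat.cast_pow, ← four_mul_card_filter_mem_notMem hyz]
      push_cast
      ring
  have hsum : ∑ s : Finset V, ∑ y ∈ s, ∑ z ∈ sᶜ, B y z =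
      2 ^ Fintype.card V / 4 * ∑ y, ∑ z, B y z := by
    have hite (s : Finset V) : ∑ y ∈ s, ∑ z ∈ sᶜ, B y z =
        ∑ y, ∑ z, if y ∈ s ∧ z ∉ s then B y z else 0 := by
      simp [ite_and, ← Finset.mem_compl]
    simp only [hite, Finset.mul_sum, ← hcount]
    rw [Finset.sum_comm]
    exact Finset.sum_congr rfl fun y _ => Finset.sum_comm
  have hle : 2 ^ Fintype.card V / 4 * ∑ y, ∑ z, B y z ≤ 2 ^ Fintype.card V * M := by
    rw [← hsum]
    refine (Finset.sum_le_card_nsmul _ _ M fun s _ => h s).trans_eq ?_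
    simp
  have hpos : (0 : ℝ) < 2 ^ Fintype.card V := by positivity
  nlinarith

namespace IsCircleKernel

variable {V : Type*} [Fintype V] {K : V → V → ℝ} {q D : ℝ}

theorem sum_triangle_le (h : IsCircleKernel K q D) (a b : V) :
    ∑ c, K a b * (K a c * K b c) ≤ 2 * K a b := by
  rw [← Finset.mul_sum, mul_comm]
  rcases eq_or_ne a b with rfl | hab
  · simp [h.irrefl]
  · refine mul_le_mul_of_nonneg_right (le_of_eq_of_le ?_ (h.common a b hab)) (h.nonneg a b)
    exact Finset.sum_congr rfl fun c _ => by rw [h.symm a, h.symm b]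

theorem sq_sum_sum_triangle_le (h : IsCircleKernel K q D) (g k : V → ℝ) (c : V) :
    (∑ a, ∑ b, K a b * (K a c * K b c) * (g a * k b)) ^ 2 ≤
      4 * ((∑ a, K c a * g a ^ 2) * ∑ b, K c b * k b ^ 2) := by
  let T (a b : V) : ℝ := K a b * (K a c * K b c)
  have hT (a b : V) : 0 ≤ T a b :=
    mul_nonneg (h.nonneg _ _) (mul_nonneg (h.nonneg _ _) (h.nonneg _ _))
  have hT_symm (a b : V) : T a b = T b a := by simp only [T, h.symm a b, mul_comm]
  have hsum (r : V → ℝ) : ∑ a, ∑ b, T a b * r a ^ 2 ≤ 2 * ∑ a, K c a * r a ^ 2 := by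
    rw [Finset.mul_sum]
    refine Finset.sum_le_sum fun a _ => ?_
    rw [← Finset.sum_mul, ← mul_assoc]
    refine mul_le_mul_of_nonneg_right (le_of_eq_of_le ?_ (h.sum_triangle_le c a)) (sq_nonneg _)
    refine Finset.sum_congr rfl fun b _ => ?_
    simp only [T, h.symm a c, h.symm b c]
    ring
  have hcs := Finset.sum_sq_le_sum_mul_sum_of_sq_le_mul (Finset.univ : Finset (V × V))
    (r := fun p => T p.1 p.2 * (g p.1 * k p.2)) (f := fun p => T p.1 p.2 * g p.1 ^ 2)
    (g := fun p => T p.1 p.2 * k p.2 ^ 2) (fun p _ => mul_nonneg (hT _ _) (sq_nonneg _))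
    (fun p _ => mul_nonneg (hT _ _) (sq_nonneg _)) (fun p _ => le_of_eq (by ring))
  simp only [Fintype.sum_prod_type] at hcs
  have hk : ∑ a, ∑ b, T a b * k b ^ 2 ≤ 2 * ∑ b, K c b * k b ^ 2 := by
    rw [Finset.sum_comm]
    simpa only [hT_symm] using hsum k
  calc (∑ a, ∑ b, T a b * (g a * k b)) ^ 2
      ≤ (∑ a, ∑ b, T a b * g a ^ 2) * ∑ a, ∑ b, T a b * k b ^ 2 := hcs
    _ ≤ (2 * ∑ a, K c a * g a ^ 2) * (2 * ∑ b, K c b * k b ^ 2) :=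
        mul_le_mul (hsum g) hk
          (Finset.sum_nonneg fun _ _ => Finset.sum_nonneg fun _ _ =>
            mul_nonneg (hT _ _) (sq_nonneg _))
          (mul_nonneg zero_le_two <| Finset.sum_nonneg fun _ _ =>
            mul_nonneg (h.nonneg _ _) (sq_nonneg _))
    _ = _ := by ring

theorem sum_triangle_le_of_disjoint (h : IsCircleKernel K q D) {f g k : V → ℝ}
    (hgk : ∀ y, g y * k y = 0) (hf : ∑ y, f y ^ 2 ≤ q ^ 2) (hg : ∑ y, g y ^ 2 ≤ q ^ 2)
    (hk : ∑ y, k y ^ 2 ≤ q ^ 2) :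
    ∑ c, (∑ a, ∑ b, K a b * (K a c * K b c) * (g a * k b)) * f c ≤ 3 * q ^ 3 := by
  have hq := h.pos
  have hu : ∑ c, (∑ a, ∑ b, K a b * (K a c * K b c) * (g a * k b)) ^ 2 ≤ 8 * q ^ 4 := by
    calc ∑ c, (∑ a, ∑ b, K a b * (K a c * K b c) * (g a * k b)) ^ 2
        ≤ 4 * ∑ c, (∑ a, K c a * g a ^ 2) * ∑ b, K c b * k b ^ 2 := by
          rw [Finset.mul_sum]
          exact Finset.sum_le_sum fun c _ => h.sq_sum_sum_triangle_le g k c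
      _ ≤ 4 * (D * ∑ y, g y ^ 2 * k y ^ 2 + 2 * ((∑ y, g y ^ 2) * ∑ y, k y ^ 2)) :=
          mul_le_mul_of_nonneg_left (h.sum_sum_mul_sum_le (fun _ => sq_nonneg _)
            fun _ => sq_nonneg _) zero_le_four
      _ = 8 * ((∑ y, g y ^ 2) * ∑ y, k y ^ 2) := by
          simp only [← mul_pow, hgk]
          ring_nf
          simp
      _ ≤ 8 * (q ^ 2 * q ^ 2) := by gcongr
      _ = 8 * q ^ 4 := by ring
  refine abs_le_of_sq_le_sq' ?_ (by positivity) |>.2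
  calc (∑ c, (∑ a, ∑ b, K a b * (K a c * K b c) * (g a * k b)) * f c) ^ 2
      ≤ (∑ c, (∑ a, ∑ b, K a b * (K a c * K b c) * (g a * k b)) ^ 2) * ∑ c, f c ^ 2 :=
        Finset.sum_mul_sq_le_sq_mul_sq _ _ _
    _ ≤ 8 * q ^ 4 * q ^ 2 := by gcongr
    _ ≤ (3 * q ^ 3) ^ 2 := by nlinarith [pow_pos hq 6]

theorem sum_triangle_mul_le (h : IsCircleKernel K q D) {f g k : V → ℝ}
    (hf : ∑ y, f y ^ 2 ≤ q ^ 2) (hg : ∑ y, g y ^ 2 ≤ q ^ 2) (hk : ∑ y, k y ^ 2 ≤ q ^ 2) :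
    ∑ a, ∑ b, ∑ c, K a b * (K a c * K b c) * (g a * k b * f c) ≤ 12 * q ^ 3 := by
  classical
  have hrestrict {r : V → ℝ} (hr : ∑ y, r y ^ 2 ≤ q ^ 2) (s : Finset V) :
      ∑ y, (if y ∈ s then r y else 0) ^ 2 ≤ q ^ 2 := by
    refine (Finset.sum_le_sum fun y _ => ?_).trans hr
    split_ifs
    · exact le_rfl
    · simpa using sq_nonneg (r y)
  refine (sum_sum_le_of_forall_sum_compl_le (M := 3 * q ^ 3) (by simp [h.irrefl])
    fun s => ?_).trans_eq (by ring)
  refine le_of_eq_of_le (Eq.symm ?_) (h.sum_triangle_le_of_disjoint (f := f)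
    (g := fun y => if y ∈ s then g y else 0) (k := fun y => if y ∈ sᶜ then k y else 0)
    (fun y => by by_cases hy : y ∈ s <;> simp [hy]) hf (hrestrict hg s) (hrestrict hk sᶜ))
  simp only [Finset.sum_mul]
  rw [Finset.sum_comm]
  have hcomm (a : V) : ∑ c, ∑ b, K a b * (K a c * K b c) *
      ((if a ∈ s then g a else 0) * if b ∈ sᶜ then k b else 0) * f c =
      if a ∈ s then ∑ b ∈ sᶜ, ∑ c, K a b * (K a c * K b c) * (g a * k b * f c) else 0 := by
    rw [Finset.sum_comm]
    split_ifs <;>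
      simp only [mul_ite, ite_mul, mul_zero, zero_mul, ← mul_assoc, Finset.sum_ite_irrel,
        Finset.sum_const_zero, Finset.sum_ite_mem, Finset.univ_inter]
  simp only [hcomm, Finset.sum_ite_mem, Finset.univ_inter]

end IsCircleKernel

section ConcreteGraphs

instance : DecidableRel graphK3.Adj :=
  inferInstanceAs (DecidableRel (SimpleGraph.fromEdgeSet {s(0, 1), s(1, 2), s(2, 0)}).Adj)

instance : DecidableRel graphP2.Adj :=
  inferInstanceAs (DecidableRel (SimpleGraph.fromEdgeSet {s(0, 1), s(1, 2)}).Adj)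

instance : DecidableRel graphC4Diag.Adj :=
  inferInstanceAs (DecidableRel
    (SimpleGraph.fromEdgeSet {s(0, 1), s(1, 2), s(2, 3), s(3, 0), s(0, 2)}).Adj)

instance : DecidableRel graphC4.Adj :=
  inferInstanceAs (DecidableRel
    (SimpleGraph.fromEdgeSet {s(0, 1), s(1, 2), s(2, 3), s(3, 0)}).Adj)

instance : DecidableRel graphP3.Adj :=
  inferInstanceAs (DecidableRel (SimpleGraph.fromEdgeSet {s(0, 1), s(1, 2), s(2, 3)}).Adj)

instance : DecidableRel graphK3Tail.Adj :=
  inferInstanceAs (DecidableRel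
    (SimpleGraph.fromEdgeSet {s(0, 1), s(1, 2), s(2, 0), s(2, 3)}).Adj)

instance : DecidableRel graphY.Adj :=
  inferInstanceAs (DecidableRel (SimpleGraph.fromEdgeSet {s(2, 0), s(2, 1), s(2, 3)}).Adj)

theorem isVertexExtension_top_two : IsVertexExtension ⊥ (⊤ : SimpleGraph (Fin 2)) {0} :=
  ⟨by decide, by decide⟩

theorem isVertexExtension_graphP2 : IsVertexExtension ⊤ graphP2 {1} :=
  ⟨by decide, by decide⟩

theorem isVertexExtension_graphP3 : IsVertexExtension graphP2 graphP3 {2} :=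
  ⟨by decide, by decide⟩

theorem isVertexExtension_graphK3Tail : IsVertexExtension graphK3 graphK3Tail {2} :=
  ⟨by decide, by decide⟩

theorem isVertexExtension_graphY :
    IsVertexExtension (graphP2.comap (Equiv.swap 1 2)) graphY {2} :=
  ⟨by decide, by decide⟩

theorem isVertexExtension_graphC4 : IsVertexExtension graphP2 graphC4 {0, 2} :=
  ⟨by decide, by decide⟩

theorem isVertexExtension_graphC4Diag : IsVertexExtension graphK3 graphC4Diag {0, 2} :=
  ⟨by decide, by decide⟩

theorem graphK3_eq_top : graphK3 = ⊤ := by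
  ext i j
  revert i j
  decide

variable {V : Type*}

theorem edgeProduct_top_two (K : V → V → ℝ) (x : Fin 2 → V) :
    edgeProduct K ⊤ x = K (x 0) (x 1) := by
  simp [edgeProduct_eq_prod_prod, Fin.prod_univ_two]

theorem edgeProduct_graphK3 (K : V → V → ℝ) (x : Fin 3 → V) :
    edgeProduct K graphK3 x = K (x 0) (x 1) * (K (x 0) (x 2) * K (x 1) (x 2)) := by
  simp [edgeProduct_eq_prod_prod, Fin.prod_univ_three, graphK3_eq_top, mul_assoc]

theorem sum_fin_three_arrow [Fintype V] (g : (Fin 3 → V) → ℝ) :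
    ∑ x, g x = ∑ a, ∑ b, ∑ c, g ![a, b, c] := by
  simp only [sum_fin_succ_arrow, Finset.univ_unique, Finset.sum_singleton]
  refine Finset.sum_congr rfl fun a _ => Finset.sum_congr rfl fun b _ =>
    Finset.sum_congr rfl fun c _ => congrArg g (funext fun i => ?_)
  fin_cases i <;> rfl

namespace IsCircleKernel

variable [Fintype V] {K : V → V → ℝ} {q D : ℝ} (h : IsCircleKernel K q D)

include h

theorem vertexBound_top_two : VertexBound (graphWeight K (⊤ : SimpleGraph (Fin 2))) 200 := by
  simpa using h.vertexBound_leaf isVertexExtension_top_two (vertexBound_point K)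

theorem sum_edgeProduct_top_two :
    ∑ x, edgeProduct K (⊤ : SimpleGraph (Fin 2)) x = q ^ 2 * D := by
  rw [h.sum_edgeProduct_leaf isVertexExtension_top_two, ← h.card]
  simp [edgeProduct]

theorem powerBound_graphK3_univ (hN : q ^ 3 ≤ 3 * ∑ x, edgeProduct K graphK3 x) :
    PowerBound (graphWeight K graphK3) (vertexExponent Finset.univ) 36 := by
  intro φ hφ
  have hN₀ : 0 < ∑ x, edgeProduct K graphK3 x := by linarith [pow_pos h.pos 3]
  have hexp (i : Fin 3) : vertexExponent Finset.univ i = 1 / 2 := by norm_num [vertexExponent]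
  have hsq (i : Fin 3) : ∑ y, (φ i y ^ (1 / 2 : ℝ)) ^ 2 ≤ q ^ 2 := by
    rw [← h.card]
    refine le_of_eq_of_le (Finset.sum_congr rfl fun y _ => ?_) (hφ i).2
    rw [← Real.sqrt_eq_rpow, Real.sq_sqrt ((hφ i).1 y)]
  calc ∑ x, graphWeight K graphK3 x * ∏ i, φ i (x i) ^ vertexExponent Finset.univ i
      = (∑ a, ∑ b, ∑ c, K a b * (K a c * K b c) * (φ 0 a ^ (1 / 2 : ℝ) * φ 1 b ^ (1 / 2 : ℝ) *
          φ 2 c ^ (1 / 2 : ℝ))) / ∑ x, edgeProduct K graphK3 x := by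
        simp only [graphWeight, edgeProduct_graphK3, hexp, Fin.prod_univ_three, div_mul_eq_mul_div,
          ← Finset.sum_div, sum_fin_three_arrow]
        simp
    _ ≤ 12 * q ^ 3 / ∑ x, edgeProduct K graphK3 x := by
        gcongr
        exact h.sum_triangle_mul_le (hsq 2) (hsq 0) (hsq 1)
    _ ≤ 36 := by
        rw [div_le_iff₀ hN₀]
        linarith

theorem powerBound_graphK3_map (hN : q ^ 3 ≤ 3 * ∑ x, edgeProduct K graphK3 x)
    (s : Finset (Fin 2)) :
    PowerBound (graphWeight K graphK3) (vertexExponent (s.map Fin.castSuccEmb)) 2400 := by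
  have hq := h.pos
  have hD := h.degree_pos
  have hs := h.vertexBound_top_two s ((card_finset_fin_le s).trans (by norm_num))
  refine (hs.of_sum_snoc_le (c := 12) (by norm_num) fun x => ?_).mono (by norm_num)
  have hx : ∑ z, edgeProduct K graphK3 (Fin.snoc x z) ≤ 2 * K (x 0) (x 1) := by
    simp only [edgeProduct_graphK3]
    exact h.sum_triangle_le (x 0) (x 1)
  simp only [graphWeight, ← Finset.sum_div]
  rw [edgeProduct_top_two, h.sum_edgeProduct_top_two]
  calc (∑ z, edgeProduct K graphK3 (Fin.snoc x z)) / ∑ x, edgeProduct K graphK3 x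
      ≤ 2 * K (x 0) (x 1) / (q ^ 3 / 3) := by
        gcongr
        · exact mul_nonneg zero_le_two (h.nonneg _ _)
        · linarith
    _ ≤ 2 * K (x 0) (x 1) / (q ^ 2 * D / 6) := by
        refine div_le_div_of_nonneg_left (mul_nonneg zero_le_two (h.nonneg _ _)) (by positivity) ?_
        nlinarith [h.degree_le, sq_nonneg q]
    _ = 12 * (K (x 0) (x 1) / (q ^ 2 * D)) := by
        field_simp
        ring

theorem vertexBound_graphK3 (hN : q ^ 3 ≤ 3 * ∑ x, edgeProduct K graphK3 x) :
    VertexBound (graphWeight K graphK3) 2400 := by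
  intro s _
  rcases eq_or_ne s Finset.univ with rfl | hs
  · exact (h.powerBound_graphK3_univ hN).mono (by norm_num)
  obtain ⟨i, hi⟩ : ∃ i, i ∉ s := by simpa [Finset.eq_univ_iff_forall] using hs
  let e : graphK3 ≃g graphK3 :=
    ⟨Equiv.swap i (Fin.last 2), by simp [graphK3_eq_top]⟩
  refine PowerBound.reindex e.toEquiv ?_
  have hw (y : Fin 3 → V) : graphWeight K graphK3 (y ∘ e.toEquiv.symm) = graphWeight K graphK3 y :=
    graphWeight_comp_iso h.zero_or_one h.symm e.symm y
  simp only [vertexExponent_comp, hw]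
  obtain ⟨s', hs' | hs'⟩ := exists_eq_map_castSucc (s.map e.toEquiv.symm.toEmbedding)
  · rw [hs']
    exact h.powerBound_graphK3_map hN s'
  · have hlast : Fin.last 2 ∈ s.map e.toEquiv.symm.toEmbedding :=
      hs' ▸ Finset.mem_insert_self _ _
    refine absurd ?_ hi
    simpa [Finset.mem_map_equiv, e] using hlast

end IsCircleKernel

variable {n : ℕ} {G : SimpleGraph (Fin n)} [DecidableRel G.Adj]

theorem IsStudiedGraph.minDegree_cases (hG : IsStudiedGraph G) :
    (G.minDegree = 2 ∧
      (Nonempty (graphK3 ≃g G) ∨ Nonempty (graphC4Diag ≃g G) ∨ Nonempty (graphC4 ≃g G))) ∨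
    (G.minDegree = 1 ∧ (Nonempty (graphP2 ≃g G) ∨ Nonempty (graphP3 ≃g G) ∨
      Nonempty (graphK3Tail ≃g G) ∨ Nonempty (graphY ≃g G))) := by
  rcases hG with ⟨⟨e⟩⟩ | ⟨⟨e⟩⟩ | ⟨⟨e⟩⟩ | ⟨⟨e⟩⟩ | ⟨⟨e⟩⟩ | ⟨⟨e⟩⟩ | ⟨⟨e⟩⟩
  · exact .inl ⟨e.minDegree_eq.symm.trans (by decide), .inl ⟨e⟩⟩
  · exact .inr ⟨e.minDegree_eq.symm.trans (by decide), .inl ⟨e⟩⟩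
  · exact .inl ⟨e.minDegree_eq.symm.trans (by decide), .inr (.inl ⟨e⟩)⟩
  · exact .inl ⟨e.minDegree_eq.symm.trans (by decide), .inr (.inr ⟨e⟩)⟩
  · exact .inr ⟨e.minDegree_eq.symm.trans (by decide), .inr (.inl ⟨e⟩)⟩
  · exact .inr ⟨e.minDegree_eq.symm.trans (by decide), .inr (.inr (.inl ⟨e⟩))⟩
  · exact .inr ⟨e.minDegree_eq.symm.trans (by decide), .inr (.inr (.inr ⟨e⟩))⟩

theorem IsCircleKernel.vertexBound_of_minDegree_eq_one [Fintype V] {K : V → V → ℝ} {q D : ℝ}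
    (h : IsCircleKernel K q D) (hN : q ^ 3 ≤ 3 * ∑ x, edgeProduct K graphK3 x)
    (hG : IsStudiedGraph G) (hδ : G.minDegree = 1) :
    VertexBound (graphWeight K G) 8000000 := by
  have hP2 := h.vertexBound_leaf isVertexExtension_graphP2 h.vertexBound_top_two
  rcases hG.minDegree_cases with ⟨hδ', _⟩ | ⟨_, ⟨⟨e⟩⟩ | ⟨⟨e⟩⟩ | ⟨⟨e⟩⟩ | ⟨⟨e⟩⟩⟩
  · omega
  · exact (h.vertexBound_iso e hP2).mono (by norm_num)
  · exact (h.vertexBound_iso e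
      (h.vertexBound_leaf isVertexExtension_graphP3 hP2)).mono (by norm_num)
  · exact (h.vertexBound_iso e (h.vertexBound_leaf isVertexExtension_graphK3Tail
      (h.vertexBound_graphK3 hN))).mono (by norm_num)
  · exact (h.vertexBound_iso e (h.vertexBound_leaf isVertexExtension_graphY
      (h.vertexBound_iso (SimpleGraph.Iso.comap _ _).symm hP2))).mono (by norm_num)

end ConcreteGraphs

section Circle

variable {F : Type} [Field F]

theorem sqNorm_two (x : Fin 2 → F) : sqNorm x = x 0 ^ 2 + x 1 ^ 2 := by
  simp [sqNorm, Fin.sum_univ_two]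

theorem sqNorm_sub_comm {d : ℕ} (x y : Fin d → F) : sqNorm (x - y) = sqNorm (y - x) := by
  simp only [sqNorm, Pi.sub_apply, ← neg_sub (y _) (x _), neg_sq]

theorem sphereKernel_zero_or_one {d : ℕ} (t : F) (x y : Fin d → F) :
    sphereKernel t x y = 0 ∨ sphereKernel t x y = 1 := by
  unfold sphereKernel
  split_ifs <;> simp

theorem sphereKernel_symm {d : ℕ} (t : F) (x y : Fin d → F) :
    sphereKernel t x y = sphereKernel t y x := by
  rw [sphereKernel, sqNorm_sub_comm, sphereKernel]

theorem sphereKernel_eq_one_iff {d : ℕ} {t : F} {x y : Fin d → F} :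
    sphereKernel t x y = 1 ↔ sqNorm (x - y) = t := by
  simp [sphereKernel]

theorem card_le_two_of_sq_eq {α : Type*} (s : Finset α) (f : α → F) (c : F)
    (hf : Set.InjOn f s) (hc : ∀ x ∈ s, f x ^ 2 = c) : s.card ≤ 2 := by
  classical
  have hsub : s.image f ⊆ (Polynomial.nthRoots 2 c).toFinset := fun y hy => by
    obtain ⟨x, hx, rfl⟩ := Finset.mem_image.1 hy
    exact Multiset.mem_toFinset.2 ((Polynomial.mem_nthRoots two_pos).2 (hc x hx))
  rw [← Finset.card_image_of_injOn hf]
  exact (Finset.card_le_card hsub).trans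
    ((Multiset.toFinset_card_le _).trans (Polynomial.card_nthRoots 2 c))

section CommonNeighbours

variable {t : F} {x y z : Fin 2 → F}

theorem two_mul_dot_of_mem_circles (hx : sqNorm (x - z) = t) (hy : sqNorm (y - z) = t) :
    2 * ((z 0 - x 0) * (y 0 - x 0) + (z 1 - x 1) * (y 1 - x 1)) = sqNorm (y - x) := by
  simp only [sqNorm_two, Pi.sub_apply] at hx hy ⊢
  linear_combination hx - hy

theorem sq_two_mul_cross_of_mem_circles (hx : sqNorm (x - z) = t) (hy : sqNorm (y - z) = t) :
    (2 * ((z 0 - x 0) * (y 1 - x 1) - (z 1 - x 1) * (y 0 - x 0))) ^ 2 =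
      4 * t * sqNorm (y - x) - sqNorm (y - x) ^ 2 := by
  have hdot := two_mul_dot_of_mem_circles hx hy
  simp only [sqNorm_two, Pi.sub_apply] at hx hdot ⊢
  rw [← hx]
  linear_combination (-1) * hdot * (2 * ((z 0 - x 0) * (y 0 - x 0) + (z 1 - x 1) * (y 1 - x 1)) +
    (y 0 - x 0) ^ 2 + (y 1 - x 1) ^ 2)

theorem sqNorm_sub_ne_zero_of_mem_circles (h2 : (2 : F) ≠ 0) (ht : t ≠ 0) (hxy : x ≠ y)
    (hx : sqNorm (x - z) = t) (hy : sqNorm (y - z) = t) : sqNorm (y - x) ≠ 0 := by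
  intro h0
  have hdot := two_mul_dot_of_mem_circles hx hy
  have hcross := sq_two_mul_cross_of_mem_circles hx hy
  rw [h0] at hdot hcross
  replace hdot : (z 0 - x 0) * (y 0 - x 0) + (z 1 - x 1) * (y 1 - x 1) = 0 := by
    simpa [h2] using hdot
  replace hcross : (z 0 - x 0) * (y 1 - x 1) - (z 1 - x 1) * (y 0 - x 0) = 0 := by
    simpa [h2] using hcross
  simp only [sqNorm_two, Pi.sub_apply] at hx
  have h_fst : t * (y 0 - x 0) = 0 := by
    rw [← hx]
    linear_combination (z 0 - x 0) * hdot - (z 1 - x 1) * hcross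
  have h_snd : t * (y 1 - x 1) = 0 := by
    rw [← hx]
    linear_combination (z 1 - x 1) * hdot + (z 0 - x 0) * hcross
  refine hxy (funext (Fin.forall_fin_two.2 ⟨?_, ?_⟩))
  · exact (sub_eq_zero.1 ((mul_eq_zero.1 h_fst).resolve_left ht)).symm
  · exact (sub_eq_zero.1 ((mul_eq_zero.1 h_snd).resolve_left ht)).symm

theorem card_le_two_of_forall_mem_circles (h2 : (2 : F) ≠ 0) (ht : t ≠ 0) (hxy : x ≠ y)
    (s : Finset (Fin 2 → F)) (hs : ∀ z ∈ s, sqNorm (x - z) = t ∧ sqNorm (y - z) = t) :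
    s.card ≤ 2 := by
  refine card_le_two_of_sq_eq s
    (fun z => 2 * ((z 0 - x 0) * (y 1 - x 1) - (z 1 - x 1) * (y 0 - x 0)))
    (4 * t * sqNorm (y - x) - sqNorm (y - x) ^ 2) ?_
    fun z hz => sq_two_mul_cross_of_mem_circles (hs z hz).1 (hs z hz).2
  intro z hz w hw hcross
  have hne := mul_ne_zero h2 (sqNorm_sub_ne_zero_of_mem_circles h2 ht hxy (hs z hz).1 (hs z hz).2)
  have hdot := (two_mul_dot_of_mem_circles (hs z hz).1 (hs z hz).2).trans
    (two_mul_dot_of_mem_circles (hs w hw).1 (hs w hw).2).symm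
  simp only [sqNorm_two, Pi.sub_apply] at hne hcross
  refine funext (Fin.forall_fin_two.2 ⟨mul_left_cancel₀ hne ?_, mul_left_cancel₀ hne ?_⟩)
  · linear_combination (y 0 - x 0) * hdot + (y 1 - x 1) * hcross
  · linear_combination (y 1 - x 1) * hdot - (y 0 - x 0) * hcross

end CommonNeighbours

variable [Fintype F]

open Classical in
/-- The circle `{y ∈ F² : ‖y‖ = t}`. -/
noncomputable def circleFinset (t : F) : Finset (Fin 2 → F) :=
  Finset.univ.filter fun y => sqNorm y = t

theorem mem_circleFinset {t : F} {y : Fin 2 → F} : y ∈ circleFinset t ↔ sqNorm y = t := by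
  simp [circleFinset]

theorem card_circleFinset_le (t : F) : (circleFinset t).card ≤ 2 * Fintype.card F := by
  classical
  refine Finset.card_le_mul_card_image_of_maps_to (f := fun y => y 0)
    (fun _ _ => Finset.mem_univ _) 2 fun b _ => ?_
  refine card_le_two_of_sq_eq _ (fun y => y 1) (t - b ^ 2) ?_ ?_
  · intro y hy z hz hyz
    exact funext (Fin.forall_fin_two.2
      ⟨(Finset.mem_filter.1 hy).2.trans (Finset.mem_filter.1 hz).2.symm, hyz⟩)
  · intro y hy
    obtain ⟨hyt, hyb⟩ := Finset.mem_filter.1 hy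
    rw [← mem_circleFinset.1 hyt, ← hyb, sqNorm_two]
    ring

omit [Fintype F] in
theorem exists_sqNorm_eq [Finite F] (hF : ringChar F ≠ 2) (t : F) :
    ∃ y : Fin 2 → F, sqNorm y = t := by
  have := Fintype.ofFinite F
  obtain ⟨a, b, hab⟩ := FiniteField.exists_root_sum_quadratic (R := F)
    (f := Polynomial.X ^ 2) (g := Polynomial.X ^ 2 - Polynomial.C t) (Polynomial.degree_X_pow 2)
    (Polynomial.degree_X_pow_sub_C two_pos t) (FiniteField.odd_card_of_char_ne_two hF)
  refine ⟨![a, b], ?_⟩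
  simp only [Polynomial.eval_pow, Polynomial.eval_X, Polynomial.eval_sub, Polynomial.eval_C] at hab
  simp only [sqNorm_two, Matrix.cons_val_zero, Matrix.cons_val_one]
  linear_combination hab

/- Since `‖w * z‖ = ‖w‖ * ‖z‖` for the multiplication of `F[i]`, the circles of nonzero radius
are translates of each other under multiplication, hence equally large. -/
theorem card_circleFinset_mono (hF : ringChar F ≠ 2) {s t : F} (hs : s ≠ 0) (ht : t ≠ 0) :
    (circleFinset s).card ≤ (circleFinset t).card := by
  obtain ⟨w, hw⟩ := exists_sqNorm_eq hF (t / s)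
  rw [sqNorm_two] at hw
  have hw0 : w 0 ^ 2 + w 1 ^ 2 ≠ 0 := hw ▸ div_ne_zero ht hs
  refine Finset.card_le_card_of_injOn
    (fun z => ![w 0 * z 0 - w 1 * z 1, w 0 * z 1 + w 1 * z 0]) (fun z hz => ?_) ?_
  · rw [SetLike.mem_coe, mem_circleFinset, sqNorm_two] at hz ⊢
    simp only [Matrix.cons_val_zero, Matrix.cons_val_one]
    calc _ = (w 0 ^ 2 + w 1 ^ 2) * (z 0 ^ 2 + z 1 ^ 2) := by ring
      _ = t := by rw [hw, hz, div_mul_cancel₀ _ hs]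
  · intro z _ z' _ h
    have h_re := congrFun h 0
    have h_im := congrFun h 1
    simp only [Matrix.cons_val_zero, Matrix.cons_val_one] at h_re h_im
    refine funext (Fin.forall_fin_two.2 ⟨mul_left_cancel₀ hw0 ?_, mul_left_cancel₀ hw0 ?_⟩)
    · linear_combination w 0 * h_re + w 1 * h_im
    · linear_combination w 0 * h_im - w 1 * h_re

theorem card_le_three_mul_card_circleFinset (hF : ringChar F ≠ 2) {t : F} (ht : t ≠ 0) :
    Fintype.card F ≤ 3 * (circleFinset t).card := by
  classical
  have hq : 3 ≤ Fintype.card F := by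
    have h1 := Fintype.one_lt_card (α := F)
    have h2 := FiniteField.odd_card_of_char_ne_two hF
    omega
  have hsum : Fintype.card F ^ 2 =
      (circleFinset (0 : F)).card + ∑ s ∈ Finset.univ.erase (0 : F), (circleFinset s).card := by
    rw [Finset.add_sum_erase _ (fun s => (circleFinset s).card) (Finset.mem_univ 0),
      ← Fintype.card_pi_const, ← Finset.card_univ]
    refine (Finset.card_eq_sum_card_fiberwise (f := sqNorm) fun _ _ => Finset.mem_univ _).trans ?_
    simp only [circleFinset]
  have hle : ∑ s ∈ Finset.univ.erase (0 : F), (circleFinset s).card ≤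
      (Fintype.card F - 1) * (circleFinset t).card := by
    refine (Finset.sum_le_card_nsmul _ _ _ fun s hs =>
      card_circleFinset_mono hF (Finset.ne_of_mem_erase hs) ht).trans_eq ?_
    rw [Finset.card_erase_of_mem (Finset.mem_univ _), Finset.card_univ, smul_eq_mul]
  have h0 := card_circleFinset_le (0 : F)
  obtain ⟨m, hm⟩ := Nat.exists_eq_add_of_le' hq
  rw [hm] at hsum hle h0 ⊢
  simp only [show m + 3 - 1 = m + 2 by omega] at hle
  nlinarith

theorem isCircleKernel_sphereKernel (hF : ringChar F ≠ 2) {t : F} (ht : t ≠ 0) :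
    IsCircleKernel (sphereKernel (d := 2) t) (Fintype.card F) (circleFinset t).card where
  zero_or_one := sphereKernel_zero_or_one t
  symm := sphereKernel_symm t
  irrefl x := by simp [sphereKernel, sqNorm_two, ht.symm]
  degree x := by
    rw [circleFinset, ← Finset.sum_boole]
    refine Fintype.sum_equiv (Equiv.subRight x) _ _ fun y => ?_
    rw [sphereKernel_symm, sphereKernel, Equiv.subRight_apply]
  common x y hxy := by
    classical
    have hmul (z : Fin 2 → F) : sphereKernel t z x * sphereKernel t z y =
        if sqNorm (x - z) = t ∧ sqNorm (y - z) = t then 1 else 0 := by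
      simp only [sphereKernel, ite_and, mul_ite, mul_one, mul_zero, sqNorm_sub_comm z]
      split_ifs <;> rfl
    simp only [hmul, Finset.sum_boole]
    exact_mod_cast card_le_two_of_forall_mem_circles (Ring.two_ne_zero hF) ht hxy _
      fun z hz => (Finset.mem_filter.1 hz).2
  card := by simp
  one_le := by exact_mod_cast Fintype.card_pos
  degree_le := by exact_mod_cast card_circleFinset_le t
  le_degree := by exact_mod_cast card_le_three_mul_card_circleFinset hF ht

/- The third vertex of an equilateral triangle with base `x, y` is
`(x + y) / 2 ± (√3 / 2) * (y - x)ᗮ`. -/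
omit [Fintype F] in
theorem exists_equilateral (h2 : (2 : F) ≠ 0) (h3 : IsSquare (3 : F)) (x y : Fin 2 → F) :
    ∃ z, sqNorm (x - z) = sqNorm (x - y) ∧ sqNorm (y - z) = sqNorm (x - y) := by
  obtain ⟨r, hr⟩ := h3
  refine ⟨![x 0 + (y 0 - x 0) / 2 - r / 2 * (y 1 - x 1),
    x 1 + (y 1 - x 1) / 2 + r / 2 * (y 0 - x 0)], ?_, ?_⟩ <;>
  · simp only [sqNorm_two, Pi.sub_apply, Matrix.cons_val_zero, Matrix.cons_val_one]
    field_simp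
    linear_combination (-1) * ((y 1 - x 1) ^ 2 + (y 0 - x 0) ^ 2) * hr

theorem card_cube_le_sum_edgeProduct_graphK3 (hF : ringChar F ≠ 2) (h3 : IsSquare (3 : F))
    {t : F} (ht : t ≠ 0) :
    (Fintype.card F : ℝ) ^ 3 ≤ 3 * ∑ x, edgeProduct (sphereKernel (d := 2) t) graphK3 x := by
  have h := isCircleKernel_sphereKernel hF ht
  have hbase (x y : Fin 2 → F) : sphereKernel t x y ≤
      ∑ z, sphereKernel t x y * (sphereKernel t x z * sphereKernel t y z) := by
    by_cases hxy : sqNorm (x - y) = t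
    · obtain ⟨z, hxz, hyz⟩ := exists_equilateral (Ring.two_ne_zero hF) h3 x y
      refine le_trans (le_of_eq ?_) (Finset.single_le_sum (fun z _ => ?_) (Finset.mem_univ z))
      · simp [sphereKernel, hxz, hyz, hxy]
      · exact mul_nonneg (h.nonneg _ _) (mul_nonneg (h.nonneg _ _) (h.nonneg _ _))
    · simp [sphereKernel, hxy]
  have hsum : (Fintype.card F : ℝ) ^ 2 * (circleFinset t).card ≤
      ∑ x, edgeProduct (sphereKernel (d := 2) t) graphK3 x := by
    rw [sum_fin_three_arrow, ← h.card, ← nsmul_eq_mul, ← Finset.card_univ, ← Finset.sum_const]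
    refine Finset.sum_le_sum fun x _ => ?_
    rw [← h.degree x]
    refine Finset.sum_le_sum fun y _ => (hbase x y).trans_eq ?_
    simp [edgeProduct_graphK3]
  nlinarith [mul_le_mul_of_nonneg_left h.le_degree (sq_nonneg (Fintype.card F : ℝ))]

end Circle

section Form

variable {F : Type} [Field F] [Fintype F] {d n m : ℕ}

omit [Fintype F] in
theorem sphereKernel_nonneg (t : F) (x y : Fin d → F) : 0 ≤ sphereKernel t x y := by
  rcases sphereKernel_zero_or_one t x y with h | h <;> simp [h]

theorem cast_numPlacements_eq_sum (t : F) (G : SimpleGraph (Fin n)) :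
    (numPlacements d t G : ℝ) = ∑ x, edgeProduct (sphereKernel (d := d) t) G x := by
  classical
  simp only [edgeProduct_eq_ite (sphereKernel_zero_or_one t) (sphereKernel_symm t),
    Finset.sum_boole, sphereKernel_eq_one_iff]
  rw [numPlacements, Nat.card_eq_fintype_card, Fintype.card_subtype]

theorem graphForm_eq_sum (t : F) (G : SimpleGraph (Fin n)) (f : Fin n → (Fin d → F) → ℝ) :
    graphForm t G f =
      ∑ x : Fin n → Fin d → F, graphWeight (sphereKernel t) G x * ∏ l, f l (x l) := by
  rw [graphForm, cast_numPlacements_eq_sum, Finset.mul_sum]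
  refine Finset.sum_congr rfl fun x _ => ?_
  rw [graphWeight, div_eq_inv_mul, mul_assoc, edgeProduct]

theorem avgNorm_nonneg (p : ℝ≥0∞) (f : (Fin d → F) → ℝ) : 0 ≤ avgNorm p f := by
  unfold avgNorm
  split_ifs
  · exact Real.iSup_nonneg fun x => abs_nonneg _
  · positivity

theorem sum_rpow_eq_avgNorm_rpow {p : ℝ≥0∞} (hp : 1 ≤ p) (hpt : p ≠ ∞) {f : (Fin d → F) → ℝ}
    (hf : ∀ x, 0 ≤ f x) :
    ∑ x, f x ^ p.toReal = Fintype.card (Fin d → F) * avgNorm p f ^ p.toReal := by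
  have hp0 : p.toReal ≠ 0 := (ENNReal.toReal_pos (one_pos.trans_le hp).ne' hpt).ne'
  have hsum : 0 ≤ ∑ x, f x ^ p.toReal := Finset.sum_nonneg fun x _ => Real.rpow_nonneg (hf x) _
  simp only [avgNorm, if_neg hpt, abs_of_nonneg (hf _), Fintype.card_pi_const, Nat.cast_pow]
  rw [← Real.rpow_mul (by positivity), one_div_mul_cancel hp0, Real.rpow_one,
    mul_inv_cancel_left₀ (by positivity)]

theorem exists_isDensity_le_avgNorm_mul_rpow {p : ℝ≥0∞} (hp : 1 ≤ p) {f : (Fin d → F) → ℝ}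
    (hf : ∀ x, 0 ≤ f x) :
    ∃ φ : (Fin d → F) → ℝ, IsDensity φ ∧ ∀ x, f x ≤ avgNorm p f * φ x ^ p.toReal⁻¹ := by
  by_cases hpt : p = ∞
  · refine ⟨fun _ => 1, isDensity_one, fun x => ?_⟩
    rw [Real.one_rpow, mul_one, avgNorm, if_pos hpt]
    exact (le_abs_self _).trans (le_ciSup (f := fun x => |f x|) (Set.finite_range _).bddAbove x)
  have hp0 : p.toReal ≠ 0 := (ENNReal.toReal_pos (one_pos.trans_le hp).ne' hpt).ne'
  have hsum := sum_rpow_eq_avgNorm_rpow hp hpt hf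
  have hN := avgNorm_nonneg p f
  set N := avgNorm p f
  have hdiv (x : Fin d → F) : 0 ≤ f x / N := div_nonneg (hf x) hN
  refine ⟨fun x => (f x / N) ^ p.toReal, ⟨fun x => Real.rpow_nonneg (hdiv x) _, ?_⟩, fun x => ?_⟩
  · simp only [Real.div_rpow (hf _) hN]
    rw [← Finset.sum_div, hsum, mul_div_assoc]
    exact mul_le_of_le_one_right (Nat.cast_nonneg _) (div_self_le_one _)
  · rw [Real.rpow_rpow_inv (hdiv x) hp0]
    rcases hN.eq_or_lt with hN0 | hN0
    · rw [← hN0, Real.zero_rpow hp0, mul_zero,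
        Finset.sum_eq_zero_iff_of_nonneg fun x _ => Real.rpow_nonneg (hf x) _] at hsum
      rw [← hN0, zero_mul, (Real.rpow_eq_zero (hf x) hp0).1 (hsum x (Finset.mem_univ x))]
    · rw [mul_div_cancel₀ _ hN0.ne']

theorem isFormBound_of_powerBound {t : F} {G : SimpleGraph (Fin n)} {p : Fin n → ℝ≥0∞}
    (hp : ∀ i, 1 ≤ p i) {C : ℝ≥0}
    (h : PowerBound (graphWeight (sphereKernel (d := d) t) G) (fun i => (p i).toReal⁻¹) C) :
    IsFormBound d t G p C := by
  intro f hf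
  choose φ hφ hfφ using fun i => exists_isDensity_le_avgNorm_mul_rpow (hp i) (hf i)
  have hw (x : Fin n → Fin d → F) : 0 ≤ graphWeight (sphereKernel t) G x :=
    div_nonneg (Finset.prod_nonneg fun _ _ => sphereKernel_nonneg _ _ _)
      (Finset.sum_nonneg fun _ _ => Finset.prod_nonneg fun _ _ => sphereKernel_nonneg _ _ _)
  calc graphForm t G f = ∑ x : Fin n → Fin d → F,
        graphWeight (sphereKernel t) G x * ∏ i, f i (x i) := graphForm_eq_sum t G f
    _ ≤ ∑ x : Fin n → Fin d → F, graphWeight (sphereKernel t) G x *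
        ∏ i, (avgNorm (p i) (f i) * φ i (x i) ^ (p i).toReal⁻¹) :=
      Finset.sum_le_sum fun x _ => mul_le_mul_of_nonneg_left
        (Finset.prod_le_prod (fun i _ => hf i _) fun i _ => hfφ i _) (hw x)
    _ = (∑ x : Fin n → Fin d → F,
          graphWeight (sphereKernel t) G x * ∏ i, φ i (x i) ^ (p i).toReal⁻¹) *
        ∏ i, avgNorm (p i) (f i) := by
      simp only [Finset.prod_mul_distrib, Finset.sum_mul]
      exact Finset.sum_congr rfl fun x _ => by ring
    _ ≤ C * ∏ i, avgNorm (p i) (f i) :=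
      mul_le_mul_of_nonneg_right (h φ hφ) (Finset.prod_nonneg fun i _ => avgNorm_nonneg _ _)

theorem graphForm_iso (t : F) {G : SimpleGraph (Fin m)} {G' : SimpleGraph (Fin n)} (e : G ≃g G')
    (f : Fin n → (Fin d → F) → ℝ) : graphForm t G (f ∘ e) = graphForm t G' f := by
  rw [graphForm_eq_sum, graphForm_eq_sum]
  refine (Fintype.sum_equiv (e.toEquiv.symm.arrowCongr (Equiv.refl _)) _ _ fun x => ?_).symm
  congr 1
  · exact (graphWeight_comp_iso (sphereKernel_zero_or_one t) (sphereKernel_symm t) e x).symm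
  · exact (e.toEquiv.prod_comp fun l => f l (x l)).symm

theorem IsFormBound.iso {t : F} {G : SimpleGraph (Fin m)} {G' : SimpleGraph (Fin n)}
    (e : G ≃g G') {p : Fin n → ℝ≥0∞} {C : ℝ≥0} (h : IsFormBound d t G' p C) :
    IsFormBound d t G (p ∘ e) C := by
  intro f hf
  have hfe : f = (f ∘ e.symm) ∘ e := by
    ext i : 1
    simp
  rw [hfe, graphForm_iso]
  refine (h (f ∘ e.symm) fun i => hf _).trans_eq ?_
  rw [← e.toEquiv.prod_comp]
  rfl

variable {t : ∀ (F : Type) [Field F] [Fintype F], F} {p : Fin n → ℝ≥0∞}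

theorem FormBounded.iso {G : SimpleGraph (Fin m)} {G' : SimpleGraph (Fin n)} (e : G ≃g G')
    (h : FormBounded d t G' p) : FormBounded d t G (p ∘ e) := by
  obtain ⟨C, hC, h⟩ := h
  refine ⟨C, hC, fun F _ _ hF => ?_⟩
  rw [formNorm_le_coe_iff]
  exact ((formNorm_le_coe_iff ..).1 (h F hF)).iso e

theorem FormBounded.formRestrictedBounded {G : SimpleGraph (Fin n)} (h : FormBounded d t G p) :
    FormRestrictedBounded d t G p := by
  obtain ⟨C, hC, h⟩ := h
  exact ⟨C, hC, fun F _ _ hF E => (formNorm_le_coe_iff ..).1 (h F hF) _ fun i x =>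
    Set.indicator_nonneg (fun _ _ => zero_le_one) x⟩

theorem IsStudiedGraph.formBounded_of_mem_exponentRegion {G : SimpleGraph (Fin n)}
    [DecidableRel G.Adj] (hG : IsStudiedGraph G) (hδ : G.minDegree = 1)
    (ht : ∀ (F : Type) [Field F] [Fintype F], t F ≠ 0) (hp : ∀ i, 1 ≤ p i)
    (ha : (fun i => (p i).toReal⁻¹) ∈ exponentRegion (Fin n)) : FormBounded 2 t G p := by
  refine ⟨8000000, by norm_num, fun F _ _ hF => ?_⟩
  have h := isCircleKernel_sphereKernel hF.1 (ht F)
  have hN := card_cube_le_sum_edgeProduct_graphK3 hF.1 (hF.2 rfl) (ht F)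
  rw [formNorm_le_coe_iff]
  refine isFormBound_of_powerBound hp ?_
  exact (h.vertexBound_of_minDegree_eq_one hN hG hδ).powerBound h.graphWeight_nonneg ha

end Form

section Necessity

variable {F : Type} [Field F] [Fintype F] {d n : ℕ} {t : F} {Z : Finset (Fin n)} {i₀ : Fin n}

theorem toReal_inv_le_one {p : ℝ≥0∞} (hp : 1 ≤ p) : p.toReal⁻¹ ≤ 1 := by
  rw [← ENNReal.toReal_inv]
  exact ENNReal.toReal_le_of_le_ofReal zero_le_one (by simpa using hp)

theorem avgNorm_indicator_le {p : ℝ≥0∞} (hp : 1 ≤ p) (E : Finset (Fin d → F)) :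
    avgNorm p ((E : Set (Fin d → F)).indicator 1) ≤
      ((E.card : ℝ) / (Fintype.card F : ℝ) ^ d) ^ p.toReal⁻¹ := by
  classical
  by_cases hpt : p = ∞
  · rw [avgNorm, if_pos hpt, hpt, ENNReal.toReal_top, inv_zero, Real.rpow_zero]
    refine ciSup_le fun x => ?_
    by_cases hx : x ∈ E <;> simp [hx]
  · have hp0 : p.toReal ≠ 0 := (ENNReal.toReal_pos (one_pos.trans_le hp).ne' hpt).ne'
    have hpow (x : Fin d → F) : |(E : Set (Fin d → F)).indicator (1 : (Fin d → F) → ℝ) x| ^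
        p.toReal = if x ∈ E then 1 else 0 := by
      by_cases hx : x ∈ E <;> simp [hx, hp0]
    simp only [avgNorm, if_neg hpt, hpow, div_eq_inv_mul]
    simp

open Classical in
/-- The sets whose indicator functions test the boundedness of `Λ_G`: the vertices in `Z` are
placed at `z`, and all others on the circle about `z`. -/
noncomputable def testSet (t : F) (Z : Finset (Fin n)) (z : Fin 2 → F) (i : Fin n) :
    Finset (Fin 2 → F) :=
  if i ∈ Z then {z} else (circleFinset t).map (Equiv.addRight z).toEmbedding

theorem mem_testSet {z y : Fin 2 → F} {i : Fin n} :
    y ∈ testSet t Z z i ↔ if i ∈ Z then y = z else sqNorm (y - z) = t := by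
  unfold testSet
  split_ifs <;> simp [Finset.mem_map_equiv, mem_circleFinset, sub_eq_add_neg]

theorem avgNorm_indicator_testSet_le {p : ℝ≥0∞} (hp : 1 ≤ p) (z : Fin 2 → F) (i : Fin n) :
    avgNorm p ((testSet t Z z i : Set (Fin 2 → F)).indicator 1) ≤
      2 * (Fintype.card F : ℝ) ^ (-((if i ∈ Z then 2 else 1) * p.toReal⁻¹)) := by
  have hq : (0 : ℝ) < Fintype.card F := by exact_mod_cast Fintype.card_pos
  have hcircle : ((circleFinset t).card : ℝ) ≤ 2 * Fintype.card F := by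
    exact_mod_cast card_circleFinset_le t
  set q : ℝ := (Fintype.card F : ℝ)
  have hcard : (testSet t Z z i).card / q ^ 2 ≤ 2 * q ^ (-(if i ∈ Z then 2 else 1 : ℝ)) := by
    unfold testSet
    split_ifs
    · rw [Finset.card_singleton, Nat.cast_one, one_div, Real.rpow_neg hq.le, Real.rpow_two]
      exact le_mul_of_one_le_left (by positivity) one_le_two
    · rw [Finset.card_map, Real.rpow_neg_one, div_le_iff₀ (by positivity),
        show 2 * q⁻¹ * q ^ 2 = 2 * q by field_simp]
      exact hcircle
  calc _ ≤ ((testSet t Z z i).card / q ^ 2) ^ p.toReal⁻¹ := avgNorm_indicator_le hp _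
    _ ≤ (2 * q ^ (-(if i ∈ Z then 2 else 1 : ℝ))) ^ p.toReal⁻¹ := by gcongr
    _ = 2 ^ p.toReal⁻¹ * q ^ (-((if i ∈ Z then 2 else 1) * p.toReal⁻¹)) := by
      rw [Real.mul_rpow zero_le_two (by positivity), ← Real.rpow_mul hq.le, neg_mul]
    _ ≤ _ := by
      gcongr
      exact Real.rpow_le_self_of_one_le one_le_two (toReal_inv_le_one hp)

open Classical in
/-- The proportion of the placements of `G` in which all vertices in `Z` are placed at the same
point as `i₀`. -/
noncomputable def collapsedMass {V : Type*} [Fintype V] (K : V → V → ℝ)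
    (G : SimpleGraph (Fin n)) (Z : Finset (Fin n)) (i₀ : Fin n) : ℝ :=
  ∑ x : Fin n → V with ∀ i ∈ Z, x i = x i₀, graphWeight K G x

theorem collapsedMass_le_sum_graphForm {G : SimpleGraph (Fin n)}
    (hadj : ∀ i ∉ Z, G.Adj i i₀) :
    collapsedMass (sphereKernel (d := 2) t) G Z i₀ ≤
      ∑ z, graphForm t G fun i => (testSet t Z z i : Set (Fin 2 → F)).indicator 1 := by
  classical
  simp only [graphForm_eq_sum]
  rw [Finset.sum_comm, collapsedMass, Finset.sum_filter]
  refine Finset.sum_le_sum fun x _ => ?_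
  have hprod (z : Fin 2 → F) :
      0 ≤ ∏ i, (testSet t Z z i : Set (Fin 2 → F)).indicator (1 : (Fin 2 → F) → ℝ) (x i) :=
    Finset.prod_nonneg fun i _ => Set.indicator_nonneg (fun _ _ => zero_le_one) _
  have hN : 0 ≤ ∑ y, edgeProduct (sphereKernel (d := 2) t) G y := by
    rw [← cast_numPlacements_eq_sum]
    positivity
  rw [← Finset.mul_sum, graphWeight,
    edgeProduct_eq_ite (sphereKernel_zero_or_one t) (sphereKernel_symm t)]
  split_ifs with hZ hx hx
  · refine le_mul_of_one_le_right (div_nonneg zero_le_one hN) ?_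
    refine le_trans (Eq.ge ?_) (Finset.single_le_sum (fun z _ => hprod z)
      (Finset.mem_univ (x i₀)))
    refine Finset.prod_eq_one fun i _ => Set.indicator_of_mem ?_ (1 : (Fin 2 → F) → ℝ)
    rw [SetLike.mem_coe, mem_testSet]
    split_ifs with hi
    · exact hZ i hi
    · exact sphereKernel_eq_one_iff.1 (hx _ _ (hadj i hi))
  · simp
  · exact mul_nonneg (div_nonneg zero_le_one hN) (Finset.sum_nonneg fun z _ => hprod z)
  · simp

theorem IsFormBound.one_le {G : SimpleGraph (Fin n)} {p : Fin n → ℝ≥0∞} {C : ℝ≥0}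
    (h : IsFormBound 2 t G p C) (hp : ∀ i, 1 ≤ p i) (hadj : ∀ i ∉ Z, G.Adj i i₀) {M : ℝ}
    (hM0 : 0 ≤ M) (hM : 1 ≤ M * collapsedMass (sphereKernel (d := 2) t) G Z i₀) :
    1 ≤ M * C * 2 ^ n * (Fintype.card F : ℝ) ^
      (2 - ∑ i, (if i ∈ Z then 2 else 1) * (p i).toReal⁻¹) := by
  have hq : (0 : ℝ) < Fintype.card F := by exact_mod_cast Fintype.card_pos
  set q : ℝ := (Fintype.card F : ℝ)
  set s : ℝ := ∑ i, (if i ∈ Z then 2 else 1) * (p i).toReal⁻¹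
  have hform (z : Fin 2 → F) :
      graphForm t G (fun i => (testSet t Z z i : Set (Fin 2 → F)).indicator 1) ≤
        C * (2 ^ n * q ^ (-s)) := by
    refine (h _ fun i x => Set.indicator_nonneg (fun _ _ => zero_le_one) x).trans ?_
    refine mul_le_mul_of_nonneg_left ?_ C.2
    refine (Finset.prod_le_prod (fun i _ => avgNorm_nonneg _ _) fun i _ =>
      avgNorm_indicator_testSet_le (hp i) z i).trans_eq ?_
    rw [Finset.prod_mul_distrib, Finset.prod_const, Finset.card_univ, Fintype.card_fin,
      ← Real.rpow_sum_of_pos hq, Finset.sum_neg_distrib]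
  calc 1 ≤ M * collapsedMass (sphereKernel (d := 2) t) G Z i₀ := hM
    _ ≤ M * ∑ _z : Fin 2 → F, C * (2 ^ n * q ^ (-s)) := by
      gcongr
      exact (collapsedMass_le_sum_graphForm hadj).trans
        (Finset.sum_le_sum fun z _ => hform z)
    _ = M * C * 2 ^ n * (q ^ (2 : ℝ) * q ^ (-s)) := by
      simp only [Finset.sum_const, Finset.card_univ, Fintype.card_pi_const, nsmul_eq_mul,
        Nat.cast_pow, Real.rpow_two]
      ring
    _ = _ := by rw [← Real.rpow_add hq, sub_eq_add_neg]

theorem nonneg_of_one_le_mul_rpow {A s : ℝ}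
    (h : ∀ k : ℕ, k ≠ 0 → 1 ≤ A * ((3 : ℝ) ^ k) ^ s) : 0 ≤ s := by
  by_contra! hs
  have hlt : (3 : ℝ) ^ s < 1 := Real.rpow_lt_one_of_one_lt_of_neg (by norm_num) hs
  have hlim := (tendsto_pow_atTop_nhds_zero_of_lt_one (by positivity) hlt).const_mul A
  rw [mul_zero] at hlim
  obtain ⟨k, hk, hk0⟩ := ((hlim.eventually (gt_mem_nhds one_pos)).and
    (Filter.eventually_ne_atTop 0)).exists
  rw [Real.rpow_pow_comm zero_le_three] at hk
  exact (h k hk0).not_gt hk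

theorem exists_admissible_card_eq_three_pow {k : ℕ} (hk : k ≠ 0) :
    ∃ (F : Type) (_ : Field F) (_ : Fintype F),
      IsAdmissibleField 2 F ∧ (Fintype.card F : ℝ) = 3 ^ k := by
  let _ : Fintype (GaloisField 3 k) := Fintype.ofFinite _
  refine ⟨GaloisField 3 k, inferInstance, inferInstance, ⟨?_, fun _ => ⟨0, ?_⟩⟩, ?_⟩
  · rw [ringChar.eq (GaloisField 3 k) 3]
    norm_num
  · rw [mul_zero]
    exact CharP.cast_eq_zero (GaloisField 3 k) 3
  · rw [← Nat.card_eq_fintype_card, GaloisField.card 3 k hk]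
    norm_num

theorem FormBounded.sum_exponents_le_two {t : ∀ (F : Type) [Field F] [Fintype F], F}
    {G : SimpleGraph (Fin n)} {p : Fin n → ℝ≥0∞} (h : FormBounded 2 t G p) (hp : ∀ i, 1 ≤ p i)
    (hadj : ∀ i ∉ Z, G.Adj i i₀) {M : ℝ} (hM0 : 0 ≤ M)
    (hM : ∀ (F : Type) [Field F] [Fintype F], IsAdmissibleField 2 F →
      1 ≤ M * collapsedMass (sphereKernel (d := 2) (t F)) G Z i₀) :
    ∑ i, (if i ∈ Z then 2 else 1) * (p i).toReal⁻¹ ≤ 2 := by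
  obtain ⟨C, -, h⟩ := h
  refine sub_nonneg.1 (nonneg_of_one_le_mul_rpow (A := M * C * 2 ^ n) fun k hk => ?_)
  obtain ⟨F, _, _, hF, hcard⟩ := exists_admissible_card_eq_three_pow hk
  rw [← hcard]
  exact ((formNorm_le_coe_iff ..).1 (h F hF)).one_le hp hadj hM0 (hM F hF)

end Necessity

section Collapse

variable {V : Type*} [Fintype V] {K : V → V → ℝ} {q D M : ℝ} {n : ℕ}

theorem collapsedMass_eq_div (K : V → V → ℝ) (G : SimpleGraph (Fin n)) (Z : Finset (Fin n))
    (i₀ : Fin n) [DecidablePred fun x : Fin n → V => ∀ i ∈ Z, x i = x i₀] :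
    collapsedMass K G Z i₀ =
      (∑ x : Fin n → V with ∀ i ∈ Z, x i = x i₀, edgeProduct K G x) / ∑ x, edgeProduct K G x := by
  rw [Finset.sum_div, collapsedMass]
  congr!

theorem collapsedMass_singleton {G : SimpleGraph (Fin n)} (hN : 0 < ∑ x, edgeProduct K G x)
    (i : Fin n) : collapsedMass K G {i} i = 1 := by
  classical
  simp [collapsedMass_eq_div, div_self hN.ne']

namespace IsVertexExtension

variable {G₀ : SimpleGraph (Fin n)} {G : SimpleGraph (Fin (n + 1))} {s : Finset (Fin n)}
  {v : Fin n}

theorem edgeProduct_snoc_clone (h : IsCircleKernel K q D) (hG : IsVertexExtension G₀ G s)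
    (hv : ∀ i ∈ s, G₀.Adj i v) (x : Fin n → V) :
    edgeProduct K G (Fin.snoc x (x v)) = edgeProduct K G₀ x := by
  classical
  rw [hG.edgeProduct_snoc, edgeProduct_eq_ite h.zero_or_one h.symm]
  split_ifs with hx
  · rw [one_mul, Finset.prod_eq_one fun i hi => hx i v (hv i hi)]
  · rw [zero_mul]

theorem sum_edgeProduct_le (h : IsCircleKernel K q D) (hG : IsVertexExtension G₀ G s)
    (hv : ∀ i ∈ s, G₀.Adj i v) : ∑ x, edgeProduct K G₀ x ≤ ∑ x, edgeProduct K G x := by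
  rw [sum_fin_succ_arrow]
  refine Finset.sum_le_sum fun x _ => ?_
  rw [← hG.edgeProduct_snoc_clone h hv]
  exact Finset.single_le_sum (f := fun y => edgeProduct K G (Fin.snoc x y))
    (fun y _ => h.edgeProduct_nonneg _) (Finset.mem_univ (x v))

theorem one_le_mul_collapsedMass (h : IsCircleKernel K q D) (hG : IsVertexExtension G₀ G s)
    (hv : ∀ i ∈ s, G₀.Adj i v) (hN : 0 < ∑ x, edgeProduct K G₀ x)
    (hM : ∑ x, edgeProduct K G x ≤ M * ∑ x, edgeProduct K G₀ x) :
    1 ≤ M * collapsedMass K G {v.castSucc, Fin.last n} v.castSucc := by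
  classical
  have hmass : collapsedMass K G {v.castSucc, Fin.last n} v.castSucc =
      (∑ x, edgeProduct K G₀ x) / ∑ x, edgeProduct K G x := by
    simp [collapsedMass_eq_div, Finset.sum_filter, sum_fin_succ_arrow,
      hG.edgeProduct_snoc_clone h hv]
  rwa [hmass, mul_div_assoc', le_div_iff₀ (hN.trans_le (hG.sum_edgeProduct_le h hv)), one_mul]

end IsVertexExtension

namespace IsCircleKernel

variable (h : IsCircleKernel K q D)

include h

theorem sum_edgeProduct_graphP2 : ∑ x, edgeProduct K graphP2 x = q ^ 2 * D * D := by
  rw [h.sum_edgeProduct_leaf isVertexExtension_graphP2, h.sum_edgeProduct_top_two]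

theorem sum_edgeProduct_graphC4Diag_le :
    ∑ x, edgeProduct K graphC4Diag x ≤ 2 * ∑ x, edgeProduct K graphK3 x := by
  rw [sum_fin_succ_arrow, Finset.mul_sum]
  refine Finset.sum_le_sum fun x _ => ?_
  calc ∑ y, edgeProduct K graphC4Diag (Fin.snoc x y)
      = K (x 0) (x 1) * K (x 1) (x 2) * ∑ y, K (x 0) (x 2) * (K (x 0) y * K (x 2) y) := by
        rw [Finset.mul_sum]
        refine Finset.sum_congr rfl fun y _ => ?_
        rw [isVertexExtension_graphC4Diag.edgeProduct_snoc, edgeProduct_graphK3,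
          Finset.prod_pair (by decide)]
        ring
    _ ≤ K (x 0) (x 1) * K (x 1) (x 2) * (2 * K (x 0) (x 2)) :=
        mul_le_mul_of_nonneg_left (h.sum_triangle_le _ _) (mul_nonneg (h.nonneg _ _) (h.nonneg _ _))
    _ = 2 * edgeProduct K graphK3 x := by
        rw [edgeProduct_graphK3]
        ring

theorem sum_edgeProduct_graphP2_closed [DecidableEq V] :
    ∑ x, (if x 0 = x 2 then edgeProduct K graphP2 x else 0) = q ^ 2 * D := by
  have hP2 (x : Fin 2 → V) :
      ∑ y, (if x 0 = y then edgeProduct K graphP2 (Fin.snoc x y) else 0) =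
        edgeProduct K ⊤ x := by
    rw [Finset.sum_ite_eq, if_pos (Finset.mem_univ _),
      isVertexExtension_graphP2.edgeProduct_snoc, Finset.prod_singleton, edgeProduct_top_two,
      h.symm (x 1), h.mul_self]
  rw [← h.sum_edgeProduct_top_two, sum_fin_succ_arrow]
  exact Finset.sum_congr rfl fun x _ => hP2 x

theorem sum_edgeProduct_graphC4_le :
    ∑ x, edgeProduct K graphC4 x ≤ 3 * ∑ x, edgeProduct K graphP2 x := by
  classical
  have hcommon (a c : V) : ∑ y, K a y * K c y ≤ 2 + if a = c then D else 0 := by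
    split_ifs with hac
    · simp only [hac, h.mul_self, h.degree]
      linarith
    · simpa only [h.symm a, h.symm c, add_zero] using h.common a c hac
  have hC4 (x : Fin 3 → V) : ∑ y, edgeProduct K graphC4 (Fin.snoc x y) =
      edgeProduct K graphP2 x * ∑ y, K (x 0) y * K (x 2) y := by
    rw [Finset.mul_sum]
    refine Finset.sum_congr rfl fun y _ => ?_
    rw [isVertexExtension_graphC4.edgeProduct_snoc, Finset.prod_pair (by decide)]
  calc ∑ x, edgeProduct K graphC4 x
      ≤ ∑ x : Fin 3 → V, edgeProduct K graphP2 x * (2 + if x 0 = x 2 then D else 0) := by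
        rw [sum_fin_succ_arrow]
        refine Finset.sum_le_sum fun x _ => (hC4 x).trans_le ?_
        exact mul_le_mul_of_nonneg_left (hcommon _ _) (h.edgeProduct_nonneg x)
    _ = 2 * ∑ x, edgeProduct K graphP2 x +
        D * ∑ x, (if x 0 = x 2 then edgeProduct K graphP2 x else 0) := by
        simp only [mul_add, Finset.sum_add_distrib, Finset.mul_sum, mul_ite, mul_zero, mul_comm]
    _ = 3 * ∑ x, edgeProduct K graphP2 x := by
        rw [h.sum_edgeProduct_graphP2_closed, h.sum_edgeProduct_graphP2]
        ring

theorem one_le_two_mul_collapsedMass_graphC4Diag (hN : 0 < ∑ x, edgeProduct K graphK3 x) :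
    1 ≤ 2 * collapsedMass K graphC4Diag {1, 3} 1 :=
  isVertexExtension_graphC4Diag.one_le_mul_collapsedMass (v := 1) h (by decide) hN
    h.sum_edgeProduct_graphC4Diag_le

theorem one_le_three_mul_collapsedMass_graphC4 :
    1 ≤ 3 * collapsedMass K graphC4 {1, 3} 1 := by
  have hq := h.pos
  have hD := h.degree_pos
  exact isVertexExtension_graphC4.one_le_mul_collapsedMass (v := 1) h (by decide)
    (by rw [h.sum_edgeProduct_graphP2]; positivity) h.sum_edgeProduct_graphC4_le

end IsCircleKernel

end Collapse

section Region

variable {ι κ : Type*} [DecidableEq ι] [DecidableEq κ]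

theorem convex_exponentRegion : Convex ℝ (exponentRegion ι) := convex_convexHull ℝ _

theorem mem_exponentRegion_of_comp (e : κ ≃ ι) {a : ι → ℝ} (h : a ∘ e ∈ exponentRegion κ) :
    a ∈ exponentRegion ι := by
  have hsub : exponentRegion κ ⊆ {b | b ∘ e.symm ∈ exponentRegion ι} := by
    refine convexHull_min ?_ fun b hb c hc r s hr hs hrs => convex_exponentRegion hb hc hr hs hrs
    rintro _ ⟨s, hs, rfl⟩
    rw [Set.mem_ofPred_eq, vertexExponent_comp]
    exact vertexExponent_mem_exponentRegion (by simpa using hs)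
  simpa [Function.comp_def] using hsub h

theorem mem_exponentRegion_of_antitone {i j k : ι} (hij : i ≠ j) (hik : i ≠ k) (hjk : j ≠ k)
    {x y z : ℝ} (hz : 0 ≤ z) (hzy : z ≤ y) (hyx : y ≤ x) (h : 2 * x + y + z ≤ 2) :
    Pi.single i x + Pi.single j y + Pi.single k z ∈ exponentRegion ι := by
  have hcard₂ : ({i, j} : Finset ι).card = 2 := Finset.card_pair hij
  have hcard₃ : ({i, j, k} : Finset ι).card = 3 :=
    Finset.card_eq_three.2 ⟨i, j, k, hij, hik, hjk, rfl⟩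
  let S : Fin 4 → Finset ι := ![∅, {i}, {i, j}, {i, j, k}]
  let w : Fin 4 → ℝ := ![1 - (2 * x + y + z) / 2, x - y, 3 / 2 * (y - z), 2 * z]
  have hw (r : Fin 4) : 0 ≤ w r := by
    fin_cases r <;> simp [w] <;> linarith
  have hw₁ : ∑ r, w r = 1 := by
    simp only [w, Fin.sum_univ_four, Matrix.cons_val]
    ring
  have hS (r : Fin 4) : (S r).card ≤ 3 := by
    fin_cases r <;> simp [S, hcard₂, hcard₃]
  convert convex_exponentRegion.sum_mem (t := Finset.univ) (fun r _ => hw r) hw₁ fun r _ =>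
    vertexExponent_mem_exponentRegion (hS r) using 1
  ext l
  simp only [Fin.sum_univ_four, S, w, Matrix.cons_val, Pi.add_apply, Pi.smul_apply, smul_eq_mul,
    vertexExponent, hcard₂, hcard₃, Finset.card_singleton, Finset.mem_insert,
    Finset.mem_singleton, Finset.notMem_empty, if_false, Pi.single_apply]
  rcases eq_or_ne l i with rfl | hi
  · simp only [hij, hik, if_true, true_or, if_false]
    push_cast
    ring
  rcases eq_or_ne l j with rfl | hj
  · simp [hi, hjk]
    ring
  rcases eq_or_ne l k with rfl | hk
  · simp [hi, hj]
    ring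
  · simp [hi, hj, hk]

theorem mem_exponentRegion_of_three {i j k : ι} (hij : i ≠ j) (hik : i ≠ k) (hjk : j ≠ k)
    {x y z : ℝ} (hx : 0 ≤ x) (hy : 0 ≤ y) (hz : 0 ≤ z) (h1 : 2 * x + y + z ≤ 2)
    (h2 : x + 2 * y + z ≤ 2) (h3 : x + y + 2 * z ≤ 2) :
    Pi.single i x + Pi.single j y + Pi.single k z ∈ exponentRegion ι := by
  rcases le_total x y with hxy | hyx
  · rcases le_total y z with hyz | hzy
    · simpa only [add_assoc, add_comm, add_left_comm] using
        mem_exponentRegion_of_antitone hjk.symm hik.symm hij.symm hx hxy hyz (by linarith)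
    rcases le_total x z with hxz | hzx
    · simpa only [add_assoc, add_comm, add_left_comm] using
        mem_exponentRegion_of_antitone hjk hij.symm hik.symm hx hxz hzy (by linarith)
    · simpa only [add_assoc, add_comm, add_left_comm] using
        mem_exponentRegion_of_antitone hij.symm hjk hik hz hzx hxy (by linarith)
  · rcases le_total z y with hzy | hyz
    · exact mem_exponentRegion_of_antitone hij hik hjk hz hzy hyx (by linarith)
    rcases le_total x z with hxz | hzx
    · simpa only [add_assoc, add_comm, add_left_comm] using
        mem_exponentRegion_of_antitone hik.symm hjk.symm hij hy hyx hxz (by linarith)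
    · simpa only [add_assoc, add_comm, add_left_comm] using
        mem_exponentRegion_of_antitone hik hij hjk.symm hy hyz hzx (by linarith)

theorem add_single_add_single_mem_exponentRegion {i j : ι} {b : ι → ℝ} {x y : ℝ} (hx : 0 ≤ x)
    (hy : 0 ≤ y) (hi : b + Pi.single i (x + y) ∈ exponentRegion ι)
    (hj : b + Pi.single j (x + y) ∈ exponentRegion ι) :
    b + Pi.single i x + Pi.single j y ∈ exponentRegion ι := by
  rcases (add_nonneg hx hy).eq_or_lt with h0 | hpos
  · obtain ⟨rfl, rfl⟩ := (add_eq_zero_iff_of_nonneg hx hy).1 h0.symm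
    simpa using hi
  · convert convex_exponentRegion hi hj (a := x / (x + y)) (b := y / (x + y)) (by positivity)
      (by positivity) (by field_simp) using 1
    ext l
    simp only [Pi.add_apply, Pi.smul_apply, smul_eq_mul, Pi.single_apply]
    split_ifs <;> field_simp <;> ring

theorem mem_exponentRegion_fin_three {a : Fin 3 → ℝ} (ha : ∀ i, 0 ≤ a i)
    (h0 : 2 * a 0 + a 1 + a 2 ≤ 2) (h1 : a 0 + 2 * a 1 + a 2 ≤ 2)
    (h2 : a 0 + a 1 + 2 * a 2 ≤ 2) : a ∈ exponentRegion (Fin 3) := by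
  rw [← Finset.univ_sum_single a, Fin.sum_univ_three]
  exact mem_exponentRegion_of_three (by decide) (by decide) (by decide) (ha 0) (ha 1) (ha 2)
    h0 h1 h2

theorem mem_exponentRegion_of_paired {a : Fin 4 → ℝ} (ha : ∀ i, 0 ≤ a i)
    (h0 : 2 * a 0 + (a 1 + a 3) + a 2 ≤ 2) (h1 : a 0 + 2 * (a 1 + a 3) + a 2 ≤ 2)
    (h2 : a 0 + (a 1 + a 3) + 2 * a 2 ≤ 2) : a ∈ exponentRegion (Fin 4) := by
  rw [← Finset.univ_sum_single a, Fin.sum_univ_four, add_right_comm (Pi.single 0 _)]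
  refine add_single_add_single_mem_exponentRegion (ha 1) (ha 3) ?_ ?_ <;>
  exact mem_exponentRegion_of_three (by decide) (by decide) (by decide) (ha 0) (ha 2)
    (add_nonneg (ha 1) (ha 3)) (by linarith) (by linarith) (by linarith)

theorem mem_exponentRegion_of_two_pairs {a : Fin 4 → ℝ} (ha : ∀ i, 0 ≤ a i)
    (h0 : 2 * (a 0 + a 2) + (a 1 + a 3) ≤ 2) (h1 : (a 0 + a 2) + 2 * (a 1 + a 3) ≤ 2) :
    a ∈ exponentRegion (Fin 4) := by
  have hmerged (i j : Fin 4) (hij : i ≠ j) :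
      Pi.single j (a 1 + a 3) + Pi.single i (a 0 + a 2) ∈ exponentRegion (Fin 4) := by
    obtain ⟨k, hik, hjk⟩ : ∃ k, i ≠ k ∧ j ≠ k := by
      revert i j
      decide
    simpa using mem_exponentRegion_of_three hij.symm hjk hik (add_nonneg (ha 1) (ha 3))
      (add_nonneg (ha 0) (ha 2)) le_rfl (by linarith) (by linarith)
      (by linarith [ha 0, ha 1, ha 2, ha 3])
  have hsplit (j : Fin 4) (hj0 : j ≠ 0) (hj2 : j ≠ 2) :
      Pi.single 0 (a 0) + Pi.single 2 (a 2) + Pi.single j (a 1 + a 3) ∈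
        exponentRegion (Fin 4) := by
    rw [add_comm, ← add_assoc]
    exact add_single_add_single_mem_exponentRegion (ha 0) (ha 2) (hmerged 0 j hj0.symm)
      (hmerged 2 j hj2.symm)
  rw [← Finset.univ_sum_single a, Fin.sum_univ_four, add_right_comm (Pi.single 0 _)]
  exact add_single_add_single_mem_exponentRegion (ha 1) (ha 3)
    (hsplit 1 (by decide) (by decide)) (hsplit 3 (by decide) (by decide))

end Region

section Main

variable {t : ∀ (F : Type) [Field F] [Fintype F], F} {n : ℕ}

theorem sum_edgeProduct_graphK3_pos {F : Type} [Field F] [Fintype F] {t : F}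
    (hF : IsAdmissibleField 2 F) (ht : t ≠ 0) :
    0 < ∑ x, edgeProduct (sphereKernel (d := 2) t) graphK3 x := by
  have hq : (0 : ℝ) < Fintype.card F := Nat.cast_pos.2 Fintype.card_pos
  linarith [pow_pos hq 3, card_cube_le_sum_edgeProduct_graphK3 hF.1 (hF.2 rfl) ht]

namespace FormBounded

theorem mem_exponentRegion_of_graphK3 {p : Fin 3 → ℝ≥0∞} (h : FormBounded 2 t graphK3 p)
    (ht : ∀ (F : Type) [Field F] [Fintype F], t F ≠ 0) (hp : ∀ i, 1 ≤ p i) :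
    (fun i => (p i).toReal⁻¹) ∈ exponentRegion (Fin 3) := by
  have key (i : Fin 3) : ∑ j, (if j ∈ ({i} : Finset (Fin 3)) then 2 else 1) * (p j).toReal⁻¹ ≤ 2 :=
    h.sum_exponents_le_two (i₀ := i) hp (by revert i; decide) zero_le_one fun F _ _ hF => by
      rw [collapsedMass_singleton (sum_edgeProduct_graphK3_pos hF (ht F)), one_mul]
  have h0 := key 0
  have h1 := key 1
  have h2 := key 2
  simp only [Fin.sum_univ_three, Finset.mem_singleton, Fin.reduceEq, if_true, if_false,
    one_mul] at h0 h1 h2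
  exact mem_exponentRegion_fin_three (fun i => inv_nonneg.2 ENNReal.toReal_nonneg) h0 h1 h2

theorem mem_exponentRegion_of_graphC4Diag {p : Fin 4 → ℝ≥0∞} (h : FormBounded 2 t graphC4Diag p)
    (ht : ∀ (F : Type) [Field F] [Fintype F], t F ≠ 0) (hp : ∀ i, 1 ≤ p i) :
    (fun i => (p i).toReal⁻¹) ∈ exponentRegion (Fin 4) := by
  have hsingle (i : Fin 4) (hi : ∀ j ∉ ({i} : Finset (Fin 4)), graphC4Diag.Adj j i) :
      ∑ j, (if j ∈ ({i} : Finset (Fin 4)) then 2 else 1) * (p j).toReal⁻¹ ≤ 2 :=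
    h.sum_exponents_le_two hp hi zero_le_one fun F _ _ hF => by
      have hK := isCircleKernel_sphereKernel hF.1 (ht F)
      rw [collapsedMass_singleton ((sum_edgeProduct_graphK3_pos hF (ht F)).trans_le
        (isVertexExtension_graphC4Diag.sum_edgeProduct_le (v := 1) hK (by decide))), one_mul]
  have h0 := hsingle 0 (by decide)
  have h1 := h.sum_exponents_le_two (Z := {1, 3}) (i₀ := 1) hp (by decide) zero_le_two
    fun F _ _ hF => (isCircleKernel_sphereKernel hF.1
      (ht F)).one_le_two_mul_collapsedMass_graphC4Diag (sum_edgeProduct_graphK3_pos hF (ht F))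
  have h2 := hsingle 2 (by decide)
  simp only [Fin.sum_univ_four, Finset.mem_insert, Finset.mem_singleton, Fin.reduceEq, or_false,
    or_true, if_true, if_false, one_mul] at h0 h1 h2
  exact mem_exponentRegion_of_paired (fun i => inv_nonneg.2 ENNReal.toReal_nonneg)
    (by linarith) (by linarith) (by linarith)

theorem two_mul_odd_exponents_le_of_graphC4 {p : Fin 4 → ℝ≥0∞} (h : FormBounded 2 t graphC4 p)
    (ht : ∀ (F : Type) [Field F] [Fintype F], t F ≠ 0) (hp : ∀ i, 1 ≤ p i) :
    ((p 0).toReal⁻¹ + (p 2).toReal⁻¹) + 2 * ((p 1).toReal⁻¹ + (p 3).toReal⁻¹) ≤ 2 := by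
  have h1 := h.sum_exponents_le_two (Z := {1, 3}) (i₀ := 1) hp (by decide) zero_le_three
    fun F _ _ hF =>
      (isCircleKernel_sphereKernel hF.1 (ht F)).one_le_three_mul_collapsedMass_graphC4
  simp only [Fin.sum_univ_four, Finset.mem_insert, Finset.mem_singleton, Fin.reduceEq, or_false,
    or_true, if_true, if_false, one_mul] at h1
  linarith

theorem mem_exponentRegion_of_graphC4 {p : Fin 4 → ℝ≥0∞} (h : FormBounded 2 t graphC4 p)
    (ht : ∀ (F : Type) [Field F] [Fintype F], t F ≠ 0) (hp : ∀ i, 1 ≤ p i) :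
    (fun i => (p i).toReal⁻¹) ∈ exponentRegion (Fin 4) := by
  let rotate : graphC4 ≃g graphC4 := ⟨finRotate 4, by decide⟩
  have hodd := h.two_mul_odd_exponents_le_of_graphC4 ht hp
  have heven : ((p 1).toReal⁻¹ + (p 3).toReal⁻¹) + 2 * ((p 2).toReal⁻¹ + (p 0).toReal⁻¹) ≤ 2 :=
    (h.iso rotate).two_mul_odd_exponents_le_of_graphC4 ht fun i => hp _
  exact mem_exponentRegion_of_two_pairs (fun i => inv_nonneg.2 ENNReal.toReal_nonneg)
    (by linarith) hodd

end FormBounded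

theorem IsStudiedGraph.mem_exponentRegion {G : SimpleGraph (Fin n)} [DecidableRel G.Adj]
    (hG : IsStudiedGraph G) (hδ : G.minDegree = 2)
    (ht : ∀ (F : Type) [Field F] [Fintype F], t F ≠ 0) {p : Fin n → ℝ≥0∞} (hp : ∀ i, 1 ≤ p i)
    (h : FormBounded 2 t G p) : (fun i => (p i).toReal⁻¹) ∈ exponentRegion (Fin n) := by
  rcases hG.minDegree_cases with ⟨_, ⟨⟨e⟩⟩ | ⟨⟨e⟩⟩ | ⟨⟨e⟩⟩⟩ | ⟨hδ', _⟩
  · exact mem_exponentRegion_of_comp e.toEquiv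
      ((h.iso e).mem_exponentRegion_of_graphK3 ht fun i => hp _)
  · exact mem_exponentRegion_of_comp e.toEquiv
      ((h.iso e).mem_exponentRegion_of_graphC4Diag ht fun i => hp _)
  · exact mem_exponentRegion_of_comp e.toEquiv
      ((h.iso e).mem_exponentRegion_of_graphC4 ht fun i => hp _)
  · omega

theorem IsExceptionalEndpoint.mem_exponentRegion {G G' : SimpleGraph (Fin n)}
    {p : Fin n → ℝ≥0∞} (h : IsExceptionalEndpoint G G' p) :
    (fun i => (p i).toReal⁻¹) ∈ exponentRegion (Fin n) := by
  obtain ⟨σ, -, -, hp⟩ := h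
  have hvertex : (fun i => (p i).toReal⁻¹) ∘ σ = vertexExponent {0, 1, 2} := by
    have hcard : ({0, 1, 2} : Finset (Fin 4)).card = 3 := by decide
    ext i
    simp only [Function.comp_apply, hp]
    fin_cases i <;> simp [vertexExponent, hcard] <;> norm_num
  refine mem_exponentRegion_of_comp σ ?_
  rw [hvertex]
  exact vertexExponent_mem_exponentRegion (by decide)

theorem theorem10p7_general (ht : ∀ (F : Type) [Field F] [Fintype F], t F ≠ 0)
    (G G' : SimpleGraph (Fin n)) [DecidableRel G.Adj] [DecidableRel G'.Adj]
    (hG : IsStudiedGraph G) (hG' : IsStudiedGraph G') (hδ : min G.minDegree 2 > G'.minDegree)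
    {p : Fin n → ℝ≥0∞} (hp : ∀ i, 1 ≤ p i) :
    (FormBounded 2 t G p → FormBounded 2 t G' p) ∧
      (IsExceptionalEndpoint G G' p → FormBounded 2 t G' p) := by
  obtain ⟨hδ₂, hδ₁⟩ : G.minDegree = 2 ∧ G'.minDegree = 1 := by
    rcases hG.minDegree_cases with ⟨h, _⟩ | ⟨h, _⟩ <;>
    rcases hG'.minDegree_cases with ⟨h', _⟩ | ⟨h', _⟩ <;> omega
  have hregion (ha : (fun i => (p i).toReal⁻¹) ∈ exponentRegion (Fin n)) : FormBounded 2 t G' p :=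
    hG'.formBounded_of_mem_exponentRegion hδ₁ ht hp ha
  exact ⟨fun h => hregion (hG.mem_exponentRegion hδ₂ ht hp h),
    fun h => hregion h.mem_exponentRegion⟩

end Main

theorem theorem10p7 (t : ∀ (F : Type) [Field F] [Fintype F], F)
    (ht : ∀ (F : Type) [Field F] [Fintype F], t F ≠ 0)
    (n : ℕ) (hn : n = 3 ∨ n = 4)
    (G G' : SimpleGraph (Fin n)) [DecidableRel G.Adj] [DecidableRel G'.Adj]
    (hG : IsStudiedGraph G) (hG' : IsStudiedGraph G') (hsub : G' ≤ G)
    (hδ : min G.minDegree 2 > G'.minDegree)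
    (p : Fin n → ℝ≥0∞) (hp : ∀ i, 1 ≤ p i) :
    (FormBounded 2 t G p → ¬ IsExceptionalEndpoint G G' p → FormBounded 2 t G' p) ∧
      (IsExceptionalEndpoint G G' p → FormRestrictedBounded 2 t G' p) := by
  obtain ⟨hbounded, hendpoint⟩ := theorem10p7_general ht G G' hG hG' hδ hp
  exact ⟨fun h _ => hbounded h, fun h => (hendpoint h).formRestrictedBounded⟩
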